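/- Let $N$ be a von Neumann algebra acting on a Hilbert space $H$, let $J\subseteq N$ be a norm-closed two-sided ideal and $\pi:N\to N/J$ the quotient map. For projections $p,q\in N$, let $p\cap q$ be the projection onto $\mathrm{Im}(p)\cap\mathrm{Im}(q)$, and for $S\in N$ let $N(S)$ be the projection onto $\ker S$. An operator $S\in qNp$ is called $(q\text{-}p)$-Fredholm if there are $T,R\in pNq$ with $\pi(TS)=\pi(p)$ and $\pi(SR)=\pi(q)$; then $N(S)\cap p$ and $N(S^*)\cap q$ lie in $J$, and the index of $S$ is $$\mathrm{Ind}_{(q\text{-}p)}(S)=[N(S)\cap p]-[N(S^*)\cap q]\in K_0(J).$$ Let $\mathcal F_{sa}$ be the set of self-adjoint $T\in N$ with $\pi(T)$ invertible in $N/J$, with the norm topology, and let $\chi$ be the indicator function of $[0,\infty)$. For a norm-continuous path $B=\{B_t\}_{t\in[0,1]}$ in $\mathcal F_{sa}$, call a partition $0=t_0<t_1<\dots<t_n=1$ admissible if $\|\pi(\chi(B_t))-\pi(\chi(B_s))\|<\tfrac12$ for all $t,s\in[t_{i-1},t_i]$ and all $i$. With $p_i=\chi(B_{t_i})$, the spectral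 flow of $B$ is defined by $$\mathrm{sf}\{B_t\}=\sum_{i=1}^n\Big([(1-p_i)\cap p_{i-1}]-[(1-p_{i-1})\cap p_i]\Big)\in K_0(J).$$ Then the following hold. 1. If $p,q,r\in N$ are projections with $\|\pi(p)-\pi(q)\|<\tfrac12$, $\|\pi(q)-\pi(r)\|<\tfrac12$ and $\|\pi(r)-\pi(p)\|<\tfrac12$, then $rq$, $qp$, $rp$ are respectively $(r\text{-}q)$-, $(q\text{-}p)$- and $(r\text{-}p)$-Fredholm, and $$\mathrm{Ind}_{(r\text{-}q)}(rq)+\mathrm{Ind}_{(q\text{-}p)}(qp)=\mathrm{Ind}_{(r\text{-}p)}(rp).$$ 2. For every norm-continuous path $B$ in $\mathcal F_{sa}$ an admissible partition exists, and $\mathrm{sf}\{B_t\}$ does not depend on the admissible partition chosen. 3. Let $B,C$ be norm-continuous paths in $\mathcal F_{sa}$ and $F:[0,1]\times[0,1]\to\mathcal F_{sa}$ a norm-continuous map with $F(t,0)=B_t$ and $F(t,1)=C_t$ for all $t\in[0,1]$, and $F(0,s)=B_0$ and $F(1,s)=B_1$ for all $s\in[0,1]$. Then $\mathrm{sf}\{B_t\}=\mathrm{sf}\{C_t\}$.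 4. Let $B,C$ be norm-continuous paths in $\mathcal F_{sa}$ with $B_t-C_t\in J$ for all $t\in[0,1]$, and put $p_0=\chi(B_0)$, $p_1=\chi(B_1)$, $q_0=\chi(C_0)$, $q_1=\chi(C_1)$. Then $p_0q_0$ is $(p_0\text{-}q_0)$-Fredholm and $q_1p_1$ is $(q_1\text{-}p_1)$-Fredholm. If $\mathrm{Ind}_{(p_0\text{-}q_0)}(p_0q_0)=0$ and $\mathrm{Ind}_{(q_1\text{-}p_1)}(q_1p_1)=0$, then $\mathrm{sf}\{B_t\}=\mathrm{sf}\{C_t\}$. Moreover, $\|p_0-q_0\|<1$ implies $\mathrm{Ind}_{(p_0\text{-}q_0)}(p_0q_0)=0$, and $\|q_1-p_1\|<1$ implies $\mathrm{Ind}_{(q_1\text{-}p_1)}(q_1p_1)=0$. -/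

import Mathlib

/-! `K₀` of rings and of (possibly non-unital) complex algebras, spectral projections, relative
Fredholm operators and spectral flow relative to a closed ideal of a von Neumann algebra. -/

noncomputable section

namespace VNFlow

/-! ### `K₀` via idempotent matrices -/

section KTheory

/-- Algebraic (Murray–von Neumann) equivalence of square matrices `e`, `f` of possibly different
sizes: there are rectangular `a`, `b` with `ab = e` and `ba = f`. -/
def MatEquiv {R : Type*} [Ring R] {ι κ : Type*} [Fintype ι] [Fintype κ]
    (e : Matrix ι ι R) (f : Matrix κ κ R) : Prop :=
  ∃ (a : Matrix ι κ R) (b : Matrix κ ι R), a * b = e ∧ b * a = f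

theorem MatEquiv.symm {R : Type*} [Ring R] {ι κ : Type*} [Fintype ι] [Fintype κ]
    {e : Matrix ι ι R} {f : Matrix κ κ R} (h : MatEquiv e f) : MatEquiv f e := by
  obtain ⟨a, b, h1, h2⟩ := h
  exact ⟨b, a, h2, h1⟩

theorem MatEquiv.trans {R : Type*} [Ring R] {ι κ l : Type*} [Fintype ι] [Fintype κ] [Fintype l]
    {e : Matrix ι ι R} {f : Matrix κ κ R} {g : Matrix l l R}
    (he : IsIdempotentElem e) (hg : IsIdempotentElem g)
    (h : MatEquiv e f) (h' : MatEquiv f g) : MatEquiv e g := by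
  obtain ⟨a, b, h1, h2⟩ := h
  obtain ⟨c, d, h3, h4⟩ := h'
  refine ⟨a * c, d * b, ?_, ?_⟩
  · calc a * c * (d * b) = a * (c * d) * b := by simp only [Matrix.mul_assoc]
      _ = (a * b) * (a * b) := by rw [h3, ← h2]; simp only [Matrix.mul_assoc]
      _ = e := by rw [h1]; exact he
  · calc d * b * (a * c) = d * (b * a) * c := by simp only [Matrix.mul_assoc]
      _ = (d * c) * (d * c) := by rw [h2, ← h3]; simp only [Matrix.mul_assoc]
      _ = g := by rw [h4]; exact hg

theorem MatEquiv.of_reindex {R : Type*} [Ring R] {ι κ : Type*} [Fintype ι] [Fintype κ]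
    {e : Matrix ι ι R} (he : IsIdempotentElem e) (σ : κ ≃ ι) :
    MatEquiv e (e.submatrix σ σ) := by
  refine ⟨e.submatrix id σ, e.submatrix σ id, ?_, ?_⟩
  · rw [Matrix.submatrix_mul_equiv]
    simpa using he.eq
  · have h := Matrix.submatrix_mul_equiv e e σ (Equiv.refl ι) σ
    simp only [Equiv.coe_refl] at h
    rw [h]
    congr 1

theorem MatEquiv.fromBlocks {R : Type*} [Ring R] {ι κ ι' κ' : Type*} [Fintype ι] [Fintype κ]
    [Fintype ι'] [Fintype κ'] {e : Matrix ι ι R} {f : Matrix κ κ R}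
    {e' : Matrix ι' ι' R} {f' : Matrix κ' κ' R} (h : MatEquiv e f) (h' : MatEquiv e' f') :
    MatEquiv (Matrix.fromBlocks e 0 0 e') (Matrix.fromBlocks f 0 0 f') := by
  obtain ⟨a, b, h1, h2⟩ := h
  obtain ⟨c, d, h3, h4⟩ := h'
  exact ⟨Matrix.fromBlocks a 0 0 c, Matrix.fromBlocks b 0 0 d,
    by simp [Matrix.fromBlocks_multiply, h1, h3], by simp [Matrix.fromBlocks_multiply, h2, h4]⟩

theorem isIdempotentElem_submatrix {R : Type*} [Ring R] {ι κ : Type*} [Fintype ι] [Fintype κ]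
    {e : Matrix ι ι R} (he : IsIdempotentElem e) (σ : κ ≃ ι) :
    IsIdempotentElem (e.submatrix σ σ) := by
  unfold IsIdempotentElem
  rw [Matrix.submatrix_mul_equiv, he]

theorem isIdempotentElem_fromBlocks {R : Type*} [Ring R] {ι κ : Type*} [Fintype ι] [Fintype κ]
    {e : Matrix ι ι R} {f : Matrix κ κ R} (he : IsIdempotentElem e) (hf : IsIdempotentElem f) :
    IsIdempotentElem (Matrix.fromBlocks e 0 0 f) := by
  unfold IsIdempotentElem
  simp [Matrix.fromBlocks_multiply, he.eq, hf.eq]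

/-- Idempotent square matrices over `R`, of arbitrary finite size. -/
structure IdemMat (R : Type*) [Ring R] where
  size : ℕ
  mat : Matrix (Fin size) (Fin size) R
  idem : IsIdempotentElem mat

instance idemSetoid (R : Type*) [Ring R] : Setoid (IdemMat R) where
  r e f := MatEquiv e.mat f.mat
  iseqv :=
    { refl := fun e => ⟨e.mat, e.mat, e.idem, e.idem⟩
      symm := fun h => h.symm
      trans := fun {e _ g} h h' => h.trans e.idem g.idem h' }

/-- Block sum `diag(e, f)`. -/
def IdemMat.dsum {R : Type*} [Ring R] (e f : IdemMat R) : IdemMat R where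
  size := e.size + f.size
  mat := (Matrix.fromBlocks e.mat 0 0 f.mat).submatrix finSumFinEquiv.symm finSumFinEquiv.symm
  idem := isIdempotentElem_submatrix (isIdempotentElem_fromBlocks e.idem f.idem) _

theorem IdemMat.dsum_equiv {R : Type*} [Ring R] (e f : IdemMat R) :
    MatEquiv (Matrix.fromBlocks e.mat 0 0 f.mat) (e.dsum f).mat :=
  MatEquiv.of_reindex (isIdempotentElem_fromBlocks e.idem f.idem) _

/-- The empty (`0 × 0`) matrix. -/
def IdemMat.zero (R : Type*) [Ring R] : IdemMat R where
  size := 0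
  mat := 0
  idem := by simp [IsIdempotentElem]

/-- The monoid `V(R)` of equivalence classes of idempotent matrices over `R`. -/
def VMon (R : Type*) [Ring R] : Type _ := Quotient (idemSetoid R)

theorem IdemMat.dsum_congr {R : Type*} [Ring R] {e e' f f' : IdemMat R}
    (h : MatEquiv e.mat e'.mat) (h' : MatEquiv f.mat f'.mat) :
    MatEquiv (e.dsum f).mat (e'.dsum f').mat :=
  ((e.dsum_equiv f).symm.trans (e.dsum f).idem
    (isIdempotentElem_fromBlocks e'.idem f'.idem) (h.fromBlocks h')).trans
    (e.dsum f).idem (e'.dsum f').idem (e'.dsum_equiv f')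

theorem IdemMat.dsum_comm {R : Type*} [Ring R] (e f : IdemMat R) :
    MatEquiv (e.dsum f).mat (f.dsum e).mat := by
  have hef := isIdempotentElem_fromBlocks e.idem f.idem
  have hfe := isIdempotentElem_fromBlocks f.idem e.idem
  have h := MatEquiv.of_reindex hef (Equiv.sumComm (Fin f.size) (Fin e.size))
  have h2 : (Matrix.fromBlocks e.mat 0 0 f.mat).submatrix
      (Equiv.sumComm (Fin f.size) (Fin e.size)) (Equiv.sumComm (Fin f.size) (Fin e.size)) =
      Matrix.fromBlocks f.mat 0 0 e.mat := by
    ext i j; rcases i with i | i <;> rcases j with j | j <;> rfl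
  rw [h2] at h
  exact ((e.dsum_equiv f).symm.trans (e.dsum f).idem hfe h).trans
    (e.dsum f).idem (f.dsum e).idem (f.dsum_equiv e)

theorem IdemMat.zero_dsum {R : Type*} [Ring R] (e : IdemMat R) :
    MatEquiv ((IdemMat.zero R).dsum e).mat e.mat := by
  refine ((IdemMat.zero R).dsum_equiv e).symm.trans ((IdemMat.zero R).dsum e).idem e.idem ?_
  refine ⟨Matrix.fromRows 0 e.mat, Matrix.fromCols 0 e.mat, ?_, ?_⟩
  · rw [Matrix.fromRows_mul_fromCols, e.idem.eq]
    ext i j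
    rcases i with i | i
    · exact i.elim0
    rcases j with j | j
    · exact j.elim0
    · rfl
  · rw [Matrix.fromCols_mul_fromRows, e.idem.eq]
    simp

theorem IdemMat.dsum_assoc {R : Type*} [Ring R] (e f g : IdemMat R) :
    MatEquiv ((e.dsum f).dsum g).mat (e.dsum (f.dsum g)).mat := by
  have hgg : MatEquiv g.mat g.mat := ⟨g.mat, g.mat, g.idem, g.idem⟩
  have hee : MatEquiv e.mat e.mat := ⟨e.mat, e.mat, e.idem, e.idem⟩
  have hl := isIdempotentElem_fromBlocks (isIdempotentElem_fromBlocks e.idem f.idem) g.idem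
  have hr := isIdempotentElem_fromBlocks e.idem (isIdempotentElem_fromBlocks f.idem g.idem)
  have h1 := ((e.dsum f).dsum_equiv g).symm.trans ((e.dsum f).dsum g).idem hl
    ((e.dsum_equiv f).symm.fromBlocks hgg)
  have h2 := (hee.fromBlocks (f.dsum_equiv g)).trans hr (e.dsum (f.dsum g)).idem
    (e.dsum_equiv (f.dsum g))
  have h := MatEquiv.of_reindex hl (Equiv.sumAssoc (Fin e.size) (Fin f.size) (Fin g.size)).symm
  have h3 : (Matrix.fromBlocks (Matrix.fromBlocks e.mat 0 0 f.mat) 0 0 g.mat).submatrix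
      (Equiv.sumAssoc (Fin e.size) (Fin f.size) (Fin g.size)).symm
      (Equiv.sumAssoc (Fin e.size) (Fin f.size) (Fin g.size)).symm =
      Matrix.fromBlocks e.mat 0 0 (Matrix.fromBlocks f.mat 0 0 g.mat) := by
    ext i j
    rcases i with i | i | i <;> rcases j with j | j | j <;> rfl
  rw [h3] at h
  exact (h1.trans ((e.dsum f).dsum g).idem hr h).trans ((e.dsum f).dsum g).idem
    (e.dsum (f.dsum g)).idem h2

instance (R : Type*) [Ring R] : Add (VMon R) where
  add := Quotient.map₂ IdemMat.dsum fun _ _ h _ _ h' => IdemMat.dsum_congr h h'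

instance (R : Type*) [Ring R] : Zero (VMon R) where
  zero := Quotient.mk _ (IdemMat.zero R)

instance (R : Type*) [Ring R] : AddCommMonoid (VMon R) where
  add_assoc := by
    rintro ⟨e⟩ ⟨f⟩ ⟨g⟩
    exact Quotient.sound (IdemMat.dsum_assoc e f g)
  add_comm := by
    rintro ⟨e⟩ ⟨f⟩
    exact Quotient.sound (IdemMat.dsum_comm e f)
  zero_add := by
    rintro ⟨e⟩
    exact Quotient.sound (IdemMat.zero_dsum e)
  add_zero := by
    rintro ⟨e⟩
    exact Quotient.sound (Setoid.trans (IdemMat.dsum_comm e _) (IdemMat.zero_dsum e))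
  nsmul := nsmulRec

theorem MatEquiv.map {R S : Type*} [Ring R] [Ring S] (φ : R →+* S) {ι κ : Type*} [Fintype ι]
    [Fintype κ] {e : Matrix ι ι R} {f : Matrix κ κ R} (h : MatEquiv e f) :
    MatEquiv (e.map φ) (f.map φ) := by
  obtain ⟨a, b, h1, h2⟩ := h
  exact ⟨a.map φ, b.map φ, by rw [← Matrix.map_mul, h1], by rw [← Matrix.map_mul, h2]⟩

/-- The image of an idempotent matrix under a ring homomorphism, entrywise. -/
def IdemMat.map {R S : Type*} [Ring R] [Ring S] (φ : R →+* S) (e : IdemMat R) : IdemMat S where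
  size := e.size
  mat := e.mat.map φ
  idem := by
    unfold IsIdempotentElem
    rw [← Matrix.map_mul, e.idem.eq]

/-- `V` is functorial. -/
def VMon.map {R S : Type*} [Ring R] [Ring S] (φ : R →+* S) : VMon R →+ VMon S where
  toFun := Quotient.map (IdemMat.map φ) fun _ _ h => MatEquiv.map φ h
  map_zero' := by
    refine Quotient.sound ?_
    have h : (IdemMat.zero R).map φ = IdemMat.zero S := by
      simp [IdemMat.map, IdemMat.zero]
    rw [h]
  map_add' := by
    rintro ⟨e⟩ ⟨f⟩
    refine Quotient.sound ?_
    have h : (e.dsum f).map φ = (e.map φ).dsum (f.map φ) := by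
      simp only [IdemMat.map, IdemMat.dsum, IdemMat.mk.injEq, heq_eq_eq, true_and]
      refine Eq.trans (congrArg (fun M => Matrix.submatrix M _ _)
        (Matrix.fromBlocks_map e.mat 0 0 f.mat φ)) ?_
      rw [Matrix.map_zero _ (map_zero φ), Matrix.map_zero _ (map_zero φ)]
      rfl
    rw [h]

/-- `K₀` of a unital ring: the Grothendieck group of `V(R)`. -/
abbrev K0U (R : Type*) [Ring R] : Type _ := Algebra.GrothendieckAddGroup (VMon R)

/-- `K₀` is functorial for unital ring homomorphisms. -/
def K0U.map {R S : Type*} [Ring R] [Ring S] (φ : R →+* S) : K0U R →+ K0U S :=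
  Algebra.GrothendieckAddGroup.lift (Algebra.GrothendieckAddGroup.of.comp (VMon.map φ))

/-- `K₀` of a possibly non-unital complex algebra `A`: the kernel of
`K₀(A⁺) → K₀(ℂ)`, where `A⁺ = ℂ ⊕ A` is the unitization. -/
abbrev K0 (A : Type*) [NonUnitalRing A] [Module ℂ A] [IsScalarTower ℂ A A]
    [SMulCommClass ℂ A A] : Type _ :=
  (K0U.map (Unitization.fstHom ℂ A : Unitization ℂ A →ₐ[ℂ] ℂ).toRingHom).ker

/-- The `1 × 1` idempotent matrix with entry `p`. -/
def IdemMat.single {R : Type*} [Ring R] (p : R) (hp : IsIdempotentElem p) : IdemMat R where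
  size := 1
  mat := Matrix.of fun _ _ => p
  idem := by
    ext i j
    simpa [Matrix.mul_apply] using hp.eq

/-- The class `[p] ∈ K₀(A)` of an idempotent `p ∈ A`. -/
def K0.cls {A : Type*} [NonUnitalRing A] [Module ℂ A] [IsScalarTower ℂ A A]
    [SMulCommClass ℂ A A] (p : A) (hp : IsIdempotentElem p) : K0 A :=
  ⟨Algebra.GrothendieckAddGroup.of
      (Quotient.mk _ (IdemMat.single (Unitization.inr p : Unitization ℂ A) (by
        unfold IsIdempotentElem
        rw [← Unitization.inr_mul, hp.eq]))), by
    rw [AddMonoidHom.mem_ker]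
    unfold K0U.map
    have h := congrArg (fun f => f (Quotient.mk (idemSetoid (Unitization ℂ A))
      (IdemMat.single (Unitization.inr p : Unitization ℂ A) (by
        unfold IsIdempotentElem
        rw [← Unitization.inr_mul, hp.eq]))))
      (Algebra.GrothendieckAddGroup.lift.symm_apply_apply
        ((Algebra.GrothendieckAddGroup.of (M := VMon ℂ)).comp
          (VMon.map (Unitization.fstHom ℂ A : Unitization ℂ A →ₐ[ℂ] ℂ).toRingHom)))
    refine Eq.trans h ?_
    refine Eq.trans (congrArg (Algebra.GrothendieckAddGroup.of (M := VMon ℂ)) ?_)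
      (map_zero (Algebra.GrothendieckAddGroup.of (M := VMon ℂ)))
    refine Quotient.sound ?_
    refine ⟨0, 0, ?_, ?_⟩
    · ext i j
      exact (Unitization.fst_inr ℂ p).symm
    · ext i
      exact i.elim0⟩

end KTheory

/-! ### Projections in a von Neumann algebra -/

section Projections

variable {H : Type*} [NormedAddCommGroup H] [InnerProductSpace ℂ H] [CompleteSpace H]

instance : SMulMemClass (VonNeumannAlgebra H) ℂ (H →L[ℂ] H) where
  smul_mem {s} z _ hx := s.toStarSubalgebra.smul_mem hx z

/-- The orthogonal projection onto the closure of `K`. -/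
def projOnto (K : Submodule ℂ H) : H →L[ℂ] H := K.topologicalClosure.starProjection

theorem projOnto_mem (N : VonNeumannAlgebra H) (K : Submodule ℂ H)
    (h : ∀ y ∈ N.commutant, ∀ x ∈ K, y x ∈ K) : projOnto K ∈ N := by
  have hp : IsStarProjection (projOnto K) := isStarProjection_starProjection
  rw [VonNeumannAlgebra.IsStarProjection.mem_iff hp]
  intro y hy
  have hr : (projOnto K).range = K.topologicalClosure := Submodule.range_starProjection _
  rw [hr, Module.End.mem_invtSubmodule]
  intro x hx
  exact map_mem_closure y.continuous hx (fun a ha => h y hy a ha)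

/-- `N(S)`: the projection onto the kernel of `S`. -/
def kerProj {N : VonNeumannAlgebra H} (S : N) : N :=
  ⟨projOnto (S : H →L[ℂ] H).ker, projOnto_mem N _ fun y hy x hx => by
    have h : (S : H →L[ℂ] H) * y = y * S := VonNeumannAlgebra.mem_commutant_iff.1 hy S S.2
    have h2 := congrArg (fun f : H →L[ℂ] H => f x) h
    simp only [mul_apply_eq_comp] at h2
    have hx' : (S : H →L[ℂ] H) x = 0 := hx
    change (S : H →L[ℂ] H) (y x) = 0
    rw [h2, hx', map_zero]⟩

/-- `p ∩ q`: the projection onto `Im(p) ∩ Im(q)`. -/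
def infProj {N : VonNeumannAlgebra H} (p q : N) : N :=
  ⟨projOnto ((p : H →L[ℂ] H).range ⊓ (q : H →L[ℂ] H).range), projOnto_mem N _ fun y hy x hx => by
    have key : ∀ s : N, x ∈ (s : H →L[ℂ] H).range → y x ∈ (s : H →L[ℂ] H).range := by
      rintro s ⟨z, hz⟩
      have h : (s : H →L[ℂ] H) * y = y * s := VonNeumannAlgebra.mem_commutant_iff.1 hy s s.2
      have h2 := congrArg (fun f : H →L[ℂ] H => f z) h
      refine ⟨y z, ?_⟩
      rw [← hz]
      exact h2
    exact ⟨key p hx.1, key q hx.2⟩⟩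

/-- The spectral projection `χ(T)` of a self-adjoint `T`, where `χ` is the indicator function of
`[0, ∞)`. The complementary projection, belonging to `(-∞, 0)`, is the projection onto the closure
of the range of the negative part `T⁻`, so `χ(T)` is the projection onto `ker T⁻`. -/
def chi {N : VonNeumannAlgebra H} (T : N) : N :=
  ⟨projOnto ((T : H →L[ℂ] H)⁻).ker, projOnto_mem N _ fun y hy x hx => by
    have h : (T : H →L[ℂ] H) * y = y * T := VonNeumannAlgebra.mem_commutant_iff.1 hy T T.2
    have h1 : Commute ((T : H →L[ℂ] H)⁻) y := by
      rw [CFC.negPart_def]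
      exact Commute.cfcₙ_real h _
    have h2 := congrArg (fun f : H →L[ℂ] H => f x) h1.eq
    simp only [mul_apply_eq_comp] at h2
    have hx' : ((T : H →L[ℂ] H)⁻) x = 0 := hx
    change ((T : H →L[ℂ] H)⁻) (y x) = 0
    rw [h2, hx', map_zero]⟩

theorem isIdempotentElem_infProj {N : VonNeumannAlgebra H} (p q : N) :
    IsIdempotentElem (infProj p q) :=
  Subtype.ext (isStarProjection_starProjection (U := _)).isIdempotentElem

theorem coe_infProj_apply_mem {N : VonNeumannAlgebra H} (p q : N) (x : H) :
    (infProj p q : H →L[ℂ] H) x ∈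
      ((p : H →L[ℂ] H).range ⊓ (q : H →L[ℂ] H).range).topologicalClosure :=
  Submodule.starProjection_apply_mem _ _

theorem mul_infProj {N : VonNeumannAlgebra H} (p q a b : N)
    (h : ∀ x : H, x ∈ (p : H →L[ℂ] H).range → x ∈ (q : H →L[ℂ] H).range →
      (a : H →L[ℂ] H) x = (b : H →L[ℂ] H) x) :
    a * infProj p q = b * infProj p q := by
  refine Subtype.ext (ContinuousLinearMap.ext fun x => ?_)
  have hc : IsClosed {x : H | (a : H →L[ℂ] H) x = (b : H →L[ℂ] H) x} :=
    isClosed_eq a.1.continuous b.1.continuous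
  exact closure_minimal (fun z hz => h z hz.1 hz.2) hc (coe_infProj_apply_mem p q x)

theorem star_infProj {N : VonNeumannAlgebra H} (p q : N) : star (infProj p q) = infProj p q :=
  Subtype.ext (isStarProjection_starProjection (U := _)).isSelfAdjoint.star_eq

theorem mem_range_kerProj {N : VonNeumannAlgebra H} (S : N) (x : H)
    (hx : x ∈ (kerProj S : H →L[ℂ] H).range) : (S : H →L[ℂ] H) x = 0 := by
  have hr : (kerProj S : H →L[ℂ] H).range = (S : H →L[ℂ] H).ker.topologicalClosure :=
    Submodule.range_starProjection _
  rw [hr, IsClosed.submodule_topologicalClosure_eq (ContinuousLinearMap.isClosed_ker _)] at hx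
  exact hx

theorem apply_of_mem_range {N : VonNeumannAlgebra H} (p : N) (hp : IsIdempotentElem p) (x : H)
    (hx : x ∈ (p : H →L[ℂ] H).range) : (p : H →L[ℂ] H) x = x := by
  obtain ⟨z, rfl⟩ := hx
  exact congrArg (fun f : N => (f : H →L[ℂ] H) z) hp

end Projections

/-! ### Fredholm operators and the index relative to an ideal -/

section Fredholm

variable {H : Type*} [NormedAddCommGroup H] [InnerProductSpace ℂ H] [CompleteSpace H]
  {N : VonNeumannAlgebra H}

/-- A two-sided ideal of `N`, viewed as a non-unital complex algebra. -/
def idealAlg (J : Ideal N) [J.IsTwoSided] : NonUnitalSubalgebra ℂ N where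
  carrier := J
  add_mem' := J.add_mem
  zero_mem' := J.zero_mem
  mul_mem' := fun {a _} _ hb => J.mul_mem_left a hb
  smul_mem' := fun z x hx => by
    have h : z • x = (z • (1 : N)) * x := by simp
    rw [h]
    exact J.mul_mem_left _ hx

/-- The class `[e] ∈ K₀(J)` of an idempotent `e ∈ J`. -/
def projClass (J : Ideal N) [J.IsTwoSided] (e : N) (he : IsIdempotentElem e) (hJ : e ∈ J) :
    K0 (idealAlg J) :=
  K0.cls ⟨e, hJ⟩ (Subtype.ext he)

/-- `S ∈ qNp` is `(q-p)`-Fredholm relative to `J`: it is invertible modulo `J` as an element of the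
skew corner. -/
def IsRelFredholm (J : Ideal N) [J.IsTwoSided] (q p S : N) : Prop :=
  S = q * S * p ∧ ∃ T R : N, T = p * T * q ∧ R = p * R * q ∧
    Ideal.Quotient.mk J (T * S) = Ideal.Quotient.mk J p ∧
    Ideal.Quotient.mk J (S * R) = Ideal.Quotient.mk J q

theorem IsRelFredholm.ker_mem {J : Ideal N} [J.IsTwoSided] {q p S : N}
    (hp : IsStarProjection p) (h : IsRelFredholm J q p S) : infProj (kerProj S) p ∈ J := by
  obtain ⟨-, T, -, -, -, hT, -⟩ := h
  have h1 : (T * S) * infProj (kerProj S) p = 0 * infProj (kerProj S) p :=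
    mul_infProj _ _ _ _ fun x hx _ => by
      change (T : H →L[ℂ] H) ((S : H →L[ℂ] H) x) = 0
      rw [mem_range_kerProj S x hx, map_zero]
  have h2 : p * infProj (kerProj S) p = 1 * infProj (kerProj S) p :=
    mul_infProj _ _ _ _ fun x _ hx => apply_of_mem_range p hp.isIdempotentElem x hx
  have h3 : infProj (kerProj S) p = -((T * S - p) * infProj (kerProj S) p) := by
    rw [sub_mul, h1, h2]; simp
  rw [h3]
  exact J.neg_mem (J.mul_mem_right _ (Ideal.Quotient.eq.1 hT))

theorem IsRelFredholm.coker_mem {J : Ideal N} [J.IsTwoSided] {q p S : N}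
    (hq : IsStarProjection q) (h : IsRelFredholm J q p S) :
    infProj (kerProj (star S)) q ∈ J := by
  obtain ⟨-, -, R, -, -, -, hR⟩ := h
  have h1 : (star R * star S) * infProj (kerProj (star S)) q =
      0 * infProj (kerProj (star S)) q :=
    mul_infProj _ _ _ _ fun x hx _ => by
      change ((star R : N) : H →L[ℂ] H) (((star S : N) : H →L[ℂ] H) x) = 0
      rw [mem_range_kerProj (star S) x hx, map_zero]
  have h2 : q * infProj (kerProj (star S)) q = 1 * infProj (kerProj (star S)) q :=
    mul_infProj _ _ _ _ fun x _ hx => apply_of_mem_range q hq.isIdempotentElem x hx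
  have h1' := congrArg star h1
  have h2' := congrArg star h2
  rw [star_mul, star_mul, star_star, star_star, star_infProj, zero_mul, star_zero] at h1'
  rw [star_mul, star_infProj, hq.isSelfAdjoint.star_eq, one_mul, star_infProj] at h2'
  have h3 : infProj (kerProj (star S)) q = -(infProj (kerProj (star S)) q * (S * R - q)) := by
    rw [mul_sub, h1', h2']; simp
  rw [h3]
  exact J.neg_mem (J.mul_mem_left _ (Ideal.Quotient.eq.1 hR))

/-- The index `Ind_(q-p)(S) = [N(S) ∩ p] - [N(S*) ∩ q] ∈ K₀(J)` of a `(q-p)`-Fredholm operator. -/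
def relIndex {J : Ideal N} [J.IsTwoSided] {q p S : N} (hq : IsStarProjection q)
    (hp : IsStarProjection p) (h : IsRelFredholm J q p S) : K0 (idealAlg J) :=
  projClass J (infProj (kerProj S) p) (isIdempotentElem_infProj _ _) (h.ker_mem hp) -
    projClass J (infProj (kerProj (star S)) q) (isIdempotentElem_infProj _ _) (h.coker_mem hq)

theorem mem_of_norm_lt_one {J : Ideal N} [J.IsTwoSided] (hJ : IsClosed (J : Set N)) {p q : N}
    (hp : IsStarProjection p) (hq : IsStarProjection q)
    (h : ‖Ideal.Quotient.mk J p - Ideal.Quotient.mk J q‖ < 1) : infProj (1 - q) p ∈ J := by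
  set e := infProj (1 - q) p with he
  have hee : e * e = e := isIdempotentElem_infProj _ _
  have hpe : p * e = 1 * e := mul_infProj _ _ _ _ fun x _ hx =>
    apply_of_mem_range p hp.isIdempotentElem x hx
  have hqe : (1 - q) * e = 1 * e := mul_infProj _ _ _ _ fun x hx _ =>
    apply_of_mem_range (1 - q) hq.isIdempotentElem.one_sub x hx
  have hpq : (p - q) * e = e := by
    have h1 : (p - q) * e = p * e - (1 * e - (1 - q) * e) := by noncomm_ring
    rw [h1, hpe, hqe]; simp
  have hle : ‖e‖ ≤ 1 := Submodule.starProjection_norm_le _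
  rw [← map_sub] at h
  obtain ⟨y, hy, hy1⟩ := Submodule.Quotient.norm_mk_lt (S := J)
    (Ideal.Quotient.mk J (p - q)) (sub_pos.2 h)
  rw [add_sub_cancel] at hy1
  have hy' : Ideal.Quotient.mk J y = Ideal.Quotient.mk J (p - q) := hy
  have hx1 : ‖e * y * e‖ < 1 := by
    calc ‖e * y * e‖ ≤ ‖e‖ * ‖y‖ * ‖e‖ :=
          (norm_mul_le _ _).trans (mul_le_mul_of_nonneg_right (norm_mul_le _ _) (norm_nonneg _))
      _ ≤ 1 * ‖y‖ * 1 := by gcongr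
      _ < 1 := by simpa using hy1
  have hmk : Ideal.Quotient.mk J (e * y * e) = Ideal.Quotient.mk J e := by
    rw [map_mul, map_mul, hy', ← map_mul, ← map_mul, mul_assoc, hpq, hee]
  have hidem : IsIdempotentElem (Ideal.Quotient.mk J e) := by
    unfold IsIdempotentElem
    rw [← map_mul, hee]
  have hlim : Filter.Tendsto (fun n : ℕ => e - (e * y * e) ^ (n + 1)) Filter.atTop (nhds e) := by
    have h0 := ((Filter.tendsto_add_atTop_iff_nat 1).2
      (tendsto_pow_atTop_nhds_zero_of_norm_lt_one hx1)).const_sub e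
    simpa using h0
  refine hJ.mem_of_tendsto hlim (Filter.Eventually.of_forall fun n => ?_)
  refine Ideal.Quotient.eq.1 ?_
  rw [map_pow, hmk, hidem.pow_succ_eq]

end Fredholm

/-! ### Spectral flow -/

section Flow

variable {H : Type*} [NormedAddCommGroup H] [InnerProductSpace ℂ H] [CompleteSpace H]
  {N : VonNeumannAlgebra H}

/-- The space `F_sa` of self-adjoint `J`-Fredholm operators, with the norm topology. -/
abbrev FredholmSA (J : Ideal N) [J.IsTwoSided] : Type _ :=
  {T : N // IsSelfAdjoint T ∧ IsUnit (Ideal.Quotient.mk J T)}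

theorem isStarProjection_chi (T : N) : IsStarProjection (chi T) where
  isIdempotentElem :=
    Subtype.ext (isStarProjection_starProjection (U := _)).isIdempotentElem
  isSelfAdjoint := Subtype.ext (isStarProjection_starProjection (U := _)).isSelfAdjoint.star_eq

/-- A partition `0 = t₀ < ⋯ < tₙ = 1` such that `‖π(χ(B_r)) - π(χ(B_s))‖ < 1/2` whenever `r, s` lie
in the same interval of the partition. -/
structure FlowPartition (J : Ideal N) [J.IsTwoSided] (B : C(unitInterval, FredholmSA J)) where
  n : ℕ
  t : Fin (n + 1) → unitInterval
  strictMono : StrictMono t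
  first : t 0 = 0
  last : t (Fin.last n) = 1
  small : ∀ i : Fin n, ∀ r ∈ Set.Icc (t i.castSucc) (t i.succ),
    ∀ s ∈ Set.Icc (t i.castSucc) (t i.succ),
      ‖Ideal.Quotient.mk J (chi (B r).1) - Ideal.Quotient.mk J (chi (B s).1)‖ < 1 / 2

/-- The projection `pᵢ = χ(B_{tᵢ})`. -/
def FlowPartition.proj {J : Ideal N} [J.IsTwoSided] {B : C(unitInterval, FredholmSA J)}
    (P : FlowPartition J B) (i : Fin (P.n + 1)) : N :=
  chi (B (P.t i)).1

theorem FlowPartition.small_proj {J : Ideal N} [J.IsTwoSided] {B : C(unitInterval, FredholmSA J)}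
    (P : FlowPartition J B) (i : Fin P.n) :
    ‖Ideal.Quotient.mk J (P.proj i.castSucc) - Ideal.Quotient.mk J (P.proj i.succ)‖ < 1 := by
  have hle : P.t i.castSucc ≤ P.t i.succ := P.strictMono.monotone i.castSucc_le_succ
  exact (P.small i _ (Set.left_mem_Icc.2 hle) _ (Set.right_mem_Icc.2 hle)).trans (by norm_num)

/-- `∑ᵢ [(1 - pᵢ) ∩ pᵢ₋₁] - [(1 - pᵢ₋₁) ∩ pᵢ] ∈ K₀(J)`, for a given partition. -/
def FlowPartition.flow {J : Ideal N} [J.IsTwoSided] (hJ : IsClosed (J : Set N))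
    {B : C(unitInterval, FredholmSA J)} (P : FlowPartition J B) : K0 (idealAlg J) :=
  ∑ i : Fin P.n,
    (projClass J (infProj (1 - P.proj i.succ) (P.proj i.castSucc))
        (isIdempotentElem_infProj _ _)
        (mem_of_norm_lt_one hJ (isStarProjection_chi _) (isStarProjection_chi _)
          (P.small_proj i)) -
      projClass J (infProj (1 - P.proj i.castSucc) (P.proj i.succ))
        (isIdempotentElem_infProj _ _)
        (mem_of_norm_lt_one hJ (isStarProjection_chi _) (isStarProjection_chi _)
          ((norm_sub_rev _ _).trans_lt (P.small_proj i))))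

open Classical in
/-- The spectral flow of a path: the value of `FlowPartition.flow` for some admissible partition
(and `0` should there be none). -/
def spectralFlow {J : Ideal N} [J.IsTwoSided] (hJ : IsClosed (J : Set N))
    (B : C(unitInterval, FredholmSA J)) : K0 (idealAlg J) :=
  if h : Nonempty (FlowPartition J B) then h.some.flow hJ else 0

end Flow

end VNFlow

end

open VNFlow

/-! For projections `p`, `q` close modulo `J`, put `essCodim J p q` = [(1 - q) ∩ p] - [(1 - p) ∩ q].
It is the index of `qp`, and each summand of the spectral flow is such a class. Everything rests on
two facts: `essCodim` is additive on triples that are pairwise closer than 1/2 modulo `J`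
(`essCodim_add`), and T ↦ π(χ(T)) is continuous on the Fredholm operators and depends only on π(T)
(`exists_qnorm_chi_sub_le`).

Additivity. Let D = p + q - 1 and U = sgn D. Then U maps the part of `p` orthogonal to e = (1 - q) ∩
p isometrically onto the part of `q` orthogonal to f = (1 - p) ∩ q (`swapSymm_intertwines`), which
gives a partial isometry `p → q` with defects exactly `e` and `f`. For three projections, the
composite `p → q → r` and the direct map `p → r` differ modulo `J` only by an element of the corner
`pNp` at distance less than 1 from `p` (`qnorm_sub_triangle_lt_one`). That element lifts to an
invertible of the corner, so the triangle may be assumed to commute modulo `J`. The three maps and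
their inverses then form 3 × 3 matrices `A`, `B` with `AB` = 1 - diag(e₃, f₁, f₂) and `BA` = 1 -
diag(e₁, e₂, f₃), and `B` agrees modulo `J` with a product of two invertible rotations. An operator
whose inverse modulo `J` lifts to an invertible has equal defect classes
(`idemClass_liftMat_of_lift`), and this equality is additivity.

Continuity. With P = χ(T) and P' = χ(T'), the element X = P(1 - P') solves |T| X + X |T'| = P(T -
T')(1 - P'). Since |T| is bounded below modulo `J`, this bounds X by T - T'; the other off-diagonal
corner is treated alike.

Given these facts, local additivity makes the sum along a subdivision independent of the subdivision
(`sum_subdivision_eq`), and cutting each square of a grid into two triangles compares neighbouring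
chains of projections (`sum_essCodim_ladder`). The latter yields both homotopy invariance and
invariance under perturbations in `J`. -/

noncomputable section

namespace VNFlow

/-! ### The quotient norm, computed through lifts to `N`. -/

section QuotientNorm

variable {H : Type*} [NormedAddCommGroup H] [InnerProductSpace ℂ H] [CompleteSpace H]
  {N : VonNeumannAlgebra H} (J : Ideal N) [J.IsTwoSided]

/-- The quotient seminorm `‖π(x)‖` on `N`. -/
def qnorm (x : N) : ℝ := ‖Ideal.Quotient.mk J x‖

theorem qnorm_nonneg (x : N) : 0 ≤ qnorm J x := norm_nonneg _

theorem qnorm_le (x : N) : qnorm J x ≤ ‖x‖ := Submodule.Quotient.norm_mk_le J x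

theorem qnorm_add_le (x y : N) : qnorm J (x + y) ≤ qnorm J x + qnorm J y := by
  unfold qnorm
  rw [map_add]
  exact norm_add_le _ _

theorem qnorm_neg (x : N) : qnorm J (-x) = qnorm J x := by
  unfold qnorm
  rw [map_neg, norm_neg]

theorem qnorm_sub_rev (x y : N) : qnorm J (x - y) = qnorm J (y - x) := by
  rw [← neg_sub, qnorm_neg]

variable {J}

theorem qnorm_congr {x y : N} (h : x - y ∈ J) : qnorm J x = qnorm J y := by
  unfold qnorm
  rw [Ideal.Quotient.eq.2 h]

theorem qnorm_of_mem {x : N} (h : x ∈ J) : qnorm J x = 0 := by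
  unfold qnorm
  rw [Ideal.Quotient.eq_zero_iff_mem.2 h, norm_zero]

theorem mem_of_qnorm_eq_zero (hJ : IsClosed (J : Set N)) {x : N} (h : qnorm J x = 0) : x ∈ J := by
  -- As an instance, closedness of `J` makes the quotient seminorm a norm.
  have := hJ
  exact Ideal.Quotient.eq_zero_iff_mem.1 ((norm_eq_zero (a := (Submodule.Quotient.mk x : N ⧸ J))).1 h)

theorem exists_sub_mem_norm_lt {x : N} {c : ℝ} (h : qnorm J x < c) :
    ∃ y, y - x ∈ J ∧ ‖y‖ < c := by
  obtain ⟨y, hy, hy1⟩ := Submodule.Quotient.norm_mk_lt (S := J)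
    (Ideal.Quotient.mk J x) (sub_pos.2 h)
  refine ⟨y, Ideal.Quotient.eq.1 hy, ?_⟩
  change ‖y‖ < qnorm J x + _ at hy1
  linarith

-- Lifts of `x` and `y` whose norms exceed the quotient norms by less than ε multiply to a lift of
-- `x * y`; let ε tend to 0.
variable (J) in
theorem qnorm_mul_le (x y : N) : qnorm J (x * y) ≤ qnorm J x * qnorm J y := by
  refine le_of_forall_gt_imp_ge_of_dense fun c hc => ?_
  have hx := qnorm_nonneg J x
  have hy := qnorm_nonneg J y
  have hcont : Filter.Tendsto (fun ε : ℝ => (qnorm J x + ε) * (qnorm J y + ε))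
      (nhdsWithin 0 (Set.Ioi 0)) (nhds (qnorm J x * qnorm J y)) := by
    have : Continuous fun ε : ℝ => (qnorm J x + ε) * (qnorm J y + ε) := by fun_prop
    simpa using (this.tendsto 0).mono_left nhdsWithin_le_nhds
  obtain ⟨ε, hε, hpos⟩ := ((hcont.eventually_lt_const hc).and self_mem_nhdsWithin).exists
  have hpos : 0 < ε := hpos
  obtain ⟨a, ha, ha1⟩ := exists_sub_mem_norm_lt (show qnorm J x < qnorm J x + ε by linarith)
  obtain ⟨b, hb, hb1⟩ := exists_sub_mem_norm_lt (show qnorm J y < qnorm J y + ε by linarith)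
  have hab : a * b - x * y ∈ J := by
    have : a * b - x * y = (a - x) * b + x * (b - y) := by noncomm_ring
    rw [this]
    exact J.add_mem (J.mul_mem_right _ ha) (J.mul_mem_left _ hb)
  rw [← qnorm_congr hab]
  calc qnorm J (a * b) ≤ ‖a * b‖ := qnorm_le J _
    _ ≤ ‖a‖ * ‖b‖ := norm_mul_le _ _
    _ ≤ (qnorm J x + ε) * (qnorm J y + ε) := by gcongr
    _ ≤ c := hε.le

theorem qnorm_mul_le_of_left_le_one {x : N} (hx : qnorm J x ≤ 1) (y : N) :
    qnorm J (x * y) ≤ qnorm J y :=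
  (qnorm_mul_le J x y).trans (mul_le_of_le_one_left (qnorm_nonneg J y) hx)

theorem qnorm_mul_le_of_right_le_one {y : N} (hy : qnorm J y ≤ 1) (x : N) :
    qnorm J (x * y) ≤ qnorm J x :=
  (qnorm_mul_le J x y).trans (mul_le_of_le_one_right (qnorm_nonneg J x) hy)

theorem qnorm_smul_le (c : ℝ) (x : N) : qnorm J ((c : ℂ) • x) ≤ |c| * qnorm J x := by
  have h : (c : ℂ) • x = ((c : ℂ) • (1 : N)) * x := by simp
  rw [h]
  refine (qnorm_mul_le J _ _).trans (mul_le_mul_of_nonneg_right ?_ (qnorm_nonneg J x))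
  refine (qnorm_le J _).trans ?_
  rw [norm_smul, Complex.norm_real]
  refine mul_le_of_le_one_right (abs_nonneg c) ?_
  exact ContinuousLinearMap.norm_id_le

theorem qnorm_smul {c : ℝ} (hc : 0 < c) (x : N) : qnorm J ((c : ℂ) • x) = c * qnorm J x := by
  refine le_antisymm (by simpa [abs_of_pos hc] using qnorm_smul_le (J := J) c x) ?_
  have h := qnorm_smul_le (J := J) c⁻¹ ((c : ℂ) • x)
  rw [smul_smul, ← Complex.ofReal_mul, inv_mul_cancel₀ hc.ne', Complex.ofReal_one, one_smul,
    abs_of_pos (inv_pos.2 hc)] at h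
  rwa [← le_div_iff₀' hc, div_eq_inv_mul]

theorem norm_le_one_of_isStarProjection {p : N} (hp : IsStarProjection p) : ‖p‖ ≤ 1 := by
  have h : IsStarProjection (p : H →L[ℂ] H) :=
    ⟨congrArg Subtype.val hp.isIdempotentElem.eq, congrArg Subtype.val hp.isSelfAdjoint.star_eq⟩
  exact h.norm_le

theorem qnorm_le_one_of_isStarProjection {p : N} (hp : IsStarProjection p) : qnorm J p ≤ 1 :=
  (qnorm_le J p).trans (norm_le_one_of_isStarProjection hp)

theorem norm_le_one_of_unitary {u : N} (h1 : star u = u) (h2 : u * u = 1) : ‖u‖ ≤ 1 := by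
  have h : ‖star (u : H →L[ℂ] H) * u‖ = ‖(u : H →L[ℂ] H)‖ * ‖(u : H →L[ℂ] H)‖ :=
    CStarRing.norm_star_mul_self
  have h3 : star (u : H →L[ℂ] H) * u = 1 := by
    rw [show star (u : H →L[ℂ] H) = u from congrArg Subtype.val h1]
    exact congrArg Subtype.val h2
  rw [h3] at h
  have h4 : ‖(1 : H →L[ℂ] H)‖ ≤ 1 := ContinuousLinearMap.norm_id_le
  change ‖(u : H →L[ℂ] H)‖ ≤ 1
  nlinarith [norm_nonneg (u : H →L[ℂ] H)]

/-- A double centralizer is norm closed. Completeness is what makes Neumann series available in `N`.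
-/
instance (N : VonNeumannAlgebra H) : CompleteSpace N := by
  have h : IsClosed (N : Set (H →L[ℂ] H)) := by
    rw [← N.centralizer_centralizer]
    exact Set.isClosed_centralizer _
  exact h.completeSpace_coe

/-- An element of the corner `pNp` within `J`-distance less than one of the unit `p` lifts to an
invertible element of the corner. -/
theorem exists_corner_inverse {p x : N} (hp : IsIdempotentElem p) (hx1 : p * x = x)
    (hx2 : x * p = x) (hx : qnorm J (p - x) < 1) (hp1 : ‖p‖ ≤ 1) :
    ∃ g g' : N, g - x ∈ J ∧ p * g = g ∧ g * p = g ∧ p * g' = g' ∧ g' * p = g' ∧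
      g * g' = p ∧ g' * g = p := by
  obtain ⟨y, hy, hy1⟩ := exists_sub_mem_norm_lt hx
  have hy' : p * y * p - (p - x) ∈ J := by
    have : p * y * p - (p - x) = p * (y - (p - x)) * p := by
      have e1 : p * (y - (p - x)) * p = p * y * p - (p * p * p - p * x * p) := by noncomm_ring
      rw [e1, hp.eq, hp.eq, hx1, hx2]
    rw [this]
    exact J.mul_mem_right _ (J.mul_mem_left _ hy)
  have hn : ‖p * y * p‖ < 1 := by
    calc ‖p * y * p‖ ≤ ‖p‖ * ‖y‖ * ‖p‖ :=
          (norm_mul_le _ _).trans (mul_le_mul_of_nonneg_right (norm_mul_le _ _) (norm_nonneg _))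
      _ ≤ 1 * ‖y‖ * 1 := by gcongr
      _ < 1 := by simpa using hy1
  -- The lift of `p - x` is compressed to the corner. By the Neumann series 1 - z is invertible in
  -- `N`, and it commutes with `p`, so (1 - z)p and (1 - z)⁻¹p are inverse to each other in `pNp`.
  set z := p * y * p with hz
  have hpz : p * z = z := by rw [hz, ← mul_assoc, ← mul_assoc, hp.eq]
  have hzp : z * p = z := by rw [hz, mul_assoc, hp.eq]
  obtain ⟨u, hu⟩ := isUnit_one_sub_of_norm_lt_one hn
  have h1 : (1 - z) * (↑u⁻¹ : N) = 1 := by rw [← hu]; exact u.mul_inv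
  have h2 : (↑u⁻¹ : N) * (1 - z) = 1 := by rw [← hu]; exact u.inv_mul
  have hc : p * (↑u⁻¹ : N) = (↑u⁻¹ : N) * p := by
    have : (1 - z) * p = p * (1 - z) := by rw [sub_mul, mul_sub, hpz, hzp, one_mul, mul_one]
    calc p * (↑u⁻¹ : N) = (↑u⁻¹ : N) * (1 - z) * p * (↑u⁻¹ : N) := by rw [h2, one_mul]
      _ = (↑u⁻¹ : N) * (p * (1 - z)) * (↑u⁻¹ : N) := by rw [mul_assoc _ (1 - z) p, this]
      _ = (↑u⁻¹ : N) * p * ((1 - z) * (↑u⁻¹ : N)) := by simp only [mul_assoc]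
      _ = (↑u⁻¹ : N) * p := by rw [h1, mul_one]
  have hg : p - z = (1 - z) * p := by rw [sub_mul, one_mul, hzp]
  refine ⟨p - z, ↑u⁻¹ * p, ?_, ?_, ?_, ?_, ?_, ?_, ?_⟩
  · have : p - z - x = -(z - (p - x)) := by abel
    rw [this]
    exact J.neg_mem hy'
  · rw [mul_sub, hpz, hp.eq]
  · rw [sub_mul, hzp, hp.eq]
  · rw [← hc, ← mul_assoc, hp.eq]
  · rw [mul_assoc, hp.eq]
  · rw [hg, mul_assoc, ← mul_assoc p, hc, mul_assoc _ p p, hp.eq, ← mul_assoc, h1, one_mul]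
  · rw [mul_assoc, mul_sub, hpz, hp.eq, hg, ← mul_assoc, h2, one_mul]

end QuotientNorm

/-! ### Modulus, spectral projection and polar decomposition. -/

section Modulus

variable {H : Type*} [NormedAddCommGroup H] [InnerProductSpace ℂ H] [CompleteSpace H]
  {N : VonNeumannAlgebra H}

/-- By the double commutant property, functional calculus applied to an element of `N` stays in `N`.
-/
theorem mem_of_forall_commute {x : H →L[ℂ] H} (h : ∀ y ∈ N.commutant, Commute x y) : x ∈ N := by
  rw [← N.commutant_commutant, VonNeumannAlgebra.mem_commutant_iff]
  exact fun y hy => (h y hy).eq.symm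

theorem commute_of_mem_commutant (T : N) {y : H →L[ℂ] H} (hy : y ∈ N.commutant) :
    Commute (T : H →L[ℂ] H) y :=
  VonNeumannAlgebra.mem_commutant_iff.1 hy T T.2

/-- The modulus `|T|`. -/
def modulus (T : N) : N :=
  ⟨CFC.abs (T : H →L[ℂ] H), mem_of_forall_commute fun _ hy =>
    (commute_of_mem_commutant T hy).cfcAbs_left (commute_of_mem_commutant T (star_mem hy))⟩

theorem modulus_mul_self (T : N) : modulus T * modulus T = star T * T :=
  Subtype.ext (CFC.abs_mul_abs (T : H →L[ℂ] H))

theorem star_modulus (T : N) : star (modulus T) = modulus T :=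
  Subtype.ext (IsSelfAdjoint.of_nonneg (CFC.abs_nonneg (T : H →L[ℂ] H))).star_eq

theorem modulus_commute {T x : N} (h : star T * T * x = x * (star T * T)) :
    modulus T * x = x * modulus T := by
  refine Subtype.ext ?_
  have h1 : Commute (star (T : H →L[ℂ] H) * T) (x : H →L[ℂ] H) := congrArg Subtype.val h
  exact (h1.cfcₙ_nnreal _).eq

/-- From 0 ≤ |T| ≤ c follows 0 ≤ c - |T| ≤ c. A lower bound |T| ≥ δ is encoded throughout as ‖c -
|T|‖ ≤ c - δ for large `c`, a form that still makes sense modulo `J`; here δ = 0. -/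
theorem norm_smul_one_sub_modulus_le (T : N) {c : ℝ} (hc : ‖modulus T‖ ≤ c) :
    ‖(c : ℂ) • (1 : N) - modulus T‖ ≤ c := by
  have h0 : 0 ≤ c := (norm_nonneg _).trans hc
  have ha : 0 ≤ CFC.abs (T : H →L[ℂ] H) := CFC.abs_nonneg _
  have hle : CFC.abs (T : H →L[ℂ] H) ≤ algebraMap ℝ _ c :=
    (CStarAlgebra.norm_le_iff_le_algebraMap _ h0 ha).1 hc
  have h1 : (((c : ℂ) • (1 : N) - modulus T : N) : H →L[ℂ] H) =
      algebraMap ℝ (H →L[ℂ] H) c - CFC.abs (T : H →L[ℂ] H) := by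
    rw [Algebra.algebraMap_eq_smul_one]
    rfl
  change ‖(((c : ℂ) • (1 : N) - modulus T : N) : H →L[ℂ] H)‖ ≤ c
  rw [h1]
  refine (CStarAlgebra.norm_le_iff_le_algebraMap _ h0 (sub_nonneg.2 hle)).2 ?_
  exact sub_le_self _ ha

theorem chi_mul_apply (T x : N) (h : ∀ v, ((T : H →L[ℂ] H)⁻) ((x : H →L[ℂ] H) v) = 0) :
    chi T * x = x := by
  refine Subtype.ext (ContinuousLinearMap.ext fun v => ?_)
  refine Submodule.starProjection_eq_self_iff.2 ?_
  exact Submodule.le_topologicalClosure _ (h v)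

theorem negPart_mul_chi (T : N) : ((T : H →L[ℂ] H)⁻) * (chi T : H →L[ℂ] H) = 0 := by
  ext v
  have hv : (chi T : H →L[ℂ] H) v ∈ ((T : H →L[ℂ] H)⁻).ker.topologicalClosure :=
    Submodule.starProjection_apply_mem _ _
  rw [IsClosed.submodule_topologicalClosure_eq (ContinuousLinearMap.isClosed_ker _)] at hv
  exact hv

theorem modulus_sub_self_mul_chi {T : N} (hT : IsSelfAdjoint T) :
    (modulus T - T) * chi T = 0 := by
  have hT' : IsSelfAdjoint (T : H →L[ℂ] H) := congrArg Subtype.val hT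
  refine Subtype.ext ?_
  change (CFC.abs (T : H →L[ℂ] H) - T) * (chi T : H →L[ℂ] H) = 0
  rw [CFC.abs_sub_self _ hT', smul_mul_assoc, negPart_mul_chi, smul_zero]

theorem chi_mul_modulus_sub_self {T : N} (hT : IsSelfAdjoint T) :
    chi T * (modulus T - T) = 0 := by
  have h := congrArg star (modulus_sub_self_mul_chi hT)
  rwa [star_mul, star_sub, star_modulus, hT.star_eq,
    (isStarProjection_chi T).isSelfAdjoint.star_eq, star_zero] at h

/-- |T| + T is twice the positive part, whose range lies in ker T⁻ because T⁻T⁺ = 0. -/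
theorem chi_mul_modulus_add_self {T : N} (hT : IsSelfAdjoint T) :
    chi T * (modulus T + T) = modulus T + T := by
  have hT' : IsSelfAdjoint (T : H →L[ℂ] H) := congrArg Subtype.val hT
  refine chi_mul_apply _ _ fun v => ?_
  change ((T : H →L[ℂ] H)⁻ * (CFC.abs (T : H →L[ℂ] H) + T)) v = 0
  rw [CFC.abs_add_self _ hT', mul_smul_comm, CFC.negPart_mul_posPart, smul_zero]
  rfl

theorem modulus_add_self_mul_chi {T : N} (hT : IsSelfAdjoint T) :
    (modulus T + T) * chi T = modulus T + T := by
  have h := congrArg star (chi_mul_modulus_add_self hT)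
  rwa [star_mul, star_add, star_modulus, hT.star_eq,
    (isStarProjection_chi T).isSelfAdjoint.star_eq] at h

theorem two_smul_cancel {x y : N} (h : x + x = y + y) : x = y := by
  have h2 : (2 : ℂ) • x = (2 : ℂ) • y := by rw [two_smul, two_smul, h]
  exact smul_right_injective N (two_ne_zero (α := ℂ)) h2

theorem chi_mul_modulus {T : N} (hT : IsSelfAdjoint T) : chi T * modulus T = chi T * T := by
  rw [← sub_eq_zero, ← mul_sub, chi_mul_modulus_sub_self hT]

theorem modulus_mul_chi {T : N} (hT : IsSelfAdjoint T) : modulus T * chi T = T * chi T := by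
  rw [← sub_eq_zero, ← sub_mul, modulus_sub_self_mul_chi hT]

theorem modulus_add_self {T : N} (hT : IsSelfAdjoint T) :
    modulus T + T = chi T * modulus T + chi T * modulus T := by
  conv_lhs => rw [← chi_mul_modulus_add_self hT, mul_add, ← chi_mul_modulus hT]

theorem chi_commute_modulus {T : N} (hT : IsSelfAdjoint T) :
    chi T * modulus T = modulus T * chi T := by
  refine two_smul_cancel ?_
  rw [← modulus_add_self hT, ← modulus_add_self_mul_chi hT, add_mul, ← modulus_mul_chi hT]

/-- Polar decomposition with a symmetry in place of a partial isometry: since χ(0) = 1, the sign is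
taken to be 1 on the kernel. -/
theorem self_eq_symmetry_mul_modulus {T : N} (hT : IsSelfAdjoint T) :
    T = (chi T + chi T - 1) * modulus T := by
  rw [sub_mul, add_mul, ← modulus_add_self hT, one_mul]; abel

end Modulus

/-! ### Norm bound for a Sylvester equation. -/

section Sylvester

variable {H : Type*} [NormedAddCommGroup H] [InnerProductSpace ℂ H] [CompleteSpace H]
  {N : VonNeumannAlgebra H} {J : Ideal N} [J.IsTwoSided]

/-- A bound for the solutions of the Sylvester equation `aX + Xb = Y` modulo `J`. -/
theorem qnorm_le_of_sylvester {a b x y : N} {c δ ε : ℝ} (hc : 0 < c)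
    (ha : qnorm J ((c : ℂ) • (1 : N) - a) ≤ c - δ) (hb : qnorm J ((c : ℂ) • (1 : N) - b) ≤ c - ε)
    (h : a * x + x * b = y) : (δ + ε) * qnorm J x ≤ qnorm J y := by
  -- Shifting both coefficients by `c` bounds 2c‖x‖ by ((c - δ) + (c - ε))‖x‖ + ‖y‖ in the quotient
  -- norm, and `c` cancels.
  have h1 : ((2 * c : ℝ) : ℂ) • x =
      ((c : ℂ) • (1 : N) - a) * x + x * ((c : ℂ) • (1 : N) - b) + y := by
    rw [← h, sub_mul, mul_sub, smul_mul_assoc, mul_smul_comm, one_mul, mul_one, two_mul,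
      Complex.ofReal_add, add_smul]
    abel
  have h2 := congrArg (qnorm J) h1
  rw [qnorm_smul (by positivity)] at h2
  have h3 := (qnorm_add_le J (((c : ℂ) • (1 : N) - a) * x + x * ((c : ℂ) • (1 : N) - b)) y)
  have h4 := qnorm_add_le J (((c : ℂ) • (1 : N) - a) * x) (x * ((c : ℂ) • (1 : N) - b))
  have h5 := (qnorm_mul_le J ((c : ℂ) • (1 : N) - a) x).trans
    (mul_le_mul_of_nonneg_right ha (qnorm_nonneg J x))
  have h6 := (qnorm_mul_le J x ((c : ℂ) • (1 : N) - b)).trans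
    (mul_le_mul_of_nonneg_left hb (qnorm_nonneg J x))
  nlinarith

end Sylvester

/-! ### Continuity of the spectral projection modulo `J`. -/

section SpectralProjection

variable {H : Type*} [NormedAddCommGroup H] [InnerProductSpace ℂ H] [CompleteSpace H]
  {N : VonNeumannAlgebra H} {J : Ideal N} [J.IsTwoSided]

theorem abs_le_of_mem_spectrum {a : H →L[ℂ] H} (ha : IsSelfAdjoint a) {x : ℝ}
    (hx : x ∈ spectrum ℝ a) : |x| ≤ ‖a‖ := by
  have h := norm_apply_le_norm_cfc (id : ℝ → ℝ) a hx
  rwa [cfc_id ℝ a] at h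

/-- If `|T|` is left invertible modulo `J`, then `|T|` is bounded below modulo `J`. -/
theorem exists_modulus_gap (hJ : IsClosed (J : Set N)) (T S : N) (hS : S * modulus T - 1 ∈ J) :
    ∃ δ : ℝ, 0 < δ ∧ ∃ M : ℝ, ∀ c : ℝ, M ≤ c → qnorm J ((c : ℂ) • (1 : N) - modulus T) ≤ c - δ := by
  set A : H →L[ℂ] H := CFC.abs (T : H →L[ℂ] H) with hA
  have hA0 : 0 ≤ A := CFC.abs_nonneg _
  have hAsa : IsSelfAdjoint A := IsSelfAdjoint.of_nonneg hA0
  have hspec : ∀ x ∈ spectrum ℝ A, 0 ≤ x := fun x hx => spectrum_nonneg_of_nonneg hA0 hx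
  -- Any δ > 0 with ‖S‖δ < 1 serves.
  set δ : ℝ := (‖S‖ + 1)⁻¹ with hδ
  have hδ0 : 0 < δ := by positivity
  have hδS : ‖S‖ * δ < 1 := by
    rw [hδ, ← div_eq_mul_inv, div_lt_one (by positivity)]
    linarith
  -- k = (δ - |T|)₊ carries the part of |T| below δ and turns out to lie in `J`: modulo `J` it
  -- equals Sⁿ|T|ⁿk, of norm at most (‖S‖δ)ⁿδ → 0.
  set k0 : H →L[ℂ] H := cfc (fun x : ℝ => max (δ - x) 0) A with hk0
  have hcomm : ∀ y ∈ N.commutant, Commute k0 y := fun y hy =>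
    Commute.cfc_real (commute_of_mem_commutant (modulus T) hy) _
  set k : N := ⟨k0, mem_of_forall_commute hcomm⟩ with hk
  have hpow : ∀ n : ℕ, ‖modulus T ^ n * k‖ ≤ δ ^ n * δ := by
    intro n
    have h1 : ((modulus T ^ n * k : N) : H →L[ℂ] H) =
        cfc (fun x : ℝ => x ^ n * max (δ - x) 0) A := by
      rw [cfc_mul (fun x : ℝ => x ^ n) (fun x : ℝ => max (δ - x) 0) A, cfc_pow_id (R := ℝ) A n]
      rfl
    change ‖((modulus T ^ n * k : N) : H →L[ℂ] H)‖ ≤ _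
    rw [h1]
    refine norm_cfc_le (by positivity) fun x hx => ?_
    have hx0 := hspec x hx
    rw [norm_mul, norm_pow, Real.norm_of_nonneg hx0, Real.norm_of_nonneg (le_max_right _ _)]
    rcases le_total x δ with hxd | hxd
    · rw [max_eq_left (by linarith)]
      gcongr
      linarith
    · rw [max_eq_right (by linarith), mul_zero]
      positivity
  have hstep : ∀ n : ℕ, qnorm J k ≤ ‖S‖ ^ n * qnorm J (modulus T ^ n * k) := by
    intro n
    induction n with
    | zero => simp
    | succ n ih =>
      refine ih.trans ?_
      rw [pow_succ, mul_assoc]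
      refine mul_le_mul_of_nonneg_left ?_ (by positivity)
      have h2 : S * (modulus T ^ (n + 1) * k) - modulus T ^ n * k ∈ J := by
        have : S * (modulus T ^ (n + 1) * k) - modulus T ^ n * k =
            (S * modulus T - 1) * (modulus T ^ n * k) := by
          rw [pow_succ']; noncomm_ring
        rw [this]
        exact J.mul_mem_right _ hS
      rw [← qnorm_congr h2]
      exact (qnorm_mul_le J _ _).trans
        (mul_le_mul_of_nonneg_right (qnorm_le J S) (qnorm_nonneg J _))
  have hkJ : qnorm J k = 0 := by
    refine le_antisymm ?_ (qnorm_nonneg J k)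
    have hlim : Filter.Tendsto (fun n : ℕ => (‖S‖ * δ) ^ n * δ) Filter.atTop (nhds 0) := by
      simpa using (tendsto_pow_atTop_nhds_zero_of_lt_one (by positivity) hδS).mul_const δ
    refine ge_of_tendsto' hlim fun n => (hstep n).trans ?_
    calc ‖S‖ ^ n * qnorm J (modulus T ^ n * k) ≤ ‖S‖ ^ n * (δ ^ n * δ) := by
          gcongr
          exact (qnorm_le J _).trans (hpow n)
      _ = (‖S‖ * δ) ^ n * δ := by rw [mul_pow]; ring
  have hkmem : k ∈ J := mem_of_qnorm_eq_zero hJ hkJ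
  refine ⟨δ, hδ0, max ‖A‖ δ, fun c hc => ?_⟩
  have hcA : ‖A‖ ≤ c := (le_max_left _ _).trans hc
  have hcδ : δ ≤ c := (le_max_right _ _).trans hc
  -- Subtracting `k` cuts the function c - x off at height c - δ, and does not change the class
  -- modulo `J`.
  have h1 : (((c : ℂ) • (1 : N) - modulus T - k : N) : H →L[ℂ] H) =
      cfc (fun x : ℝ => min (c - x) (c - δ)) A := by
    have h2 : (fun x : ℝ => min (c - x) (c - δ)) = fun x : ℝ => (c - x) - max (δ - x) 0 := by
      funext x
      rcases le_total x δ with h | h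
      · rw [min_eq_right (by linarith), max_eq_left (by linarith)]; ring
      · rw [min_eq_left (by linarith), max_eq_right (by linarith)]; ring
    rw [h2, cfc_sub (fun x : ℝ => c - x) (fun x : ℝ => max (δ - x) 0) A,
      cfc_sub (fun _ : ℝ => c) (fun x : ℝ => x) A, cfc_const c A, cfc_id' ℝ A,
      Algebra.algebraMap_eq_smul_one]
    rfl
  have h3 : ‖(c : ℂ) • (1 : N) - modulus T - k‖ ≤ c - δ := by
    change ‖(((c : ℂ) • (1 : N) - modulus T - k : N) : H →L[ℂ] H)‖ ≤ _
    rw [h1]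
    refine norm_cfc_le (by linarith) fun x hx => ?_
    have hx0 := hspec x hx
    have hx1 := (le_abs_self x).trans ((abs_le_of_mem_spectrum hAsa hx).trans hcA)
    rw [Real.norm_of_nonneg (le_min (by linarith) (by linarith))]
    exact min_le_right _ _
  refine le_trans (le_of_eq (qnorm_congr ?_)) ((qnorm_le J _).trans h3)
  rw [sub_sub_cancel]
  exact hkmem

theorem chi_commute_self {T : N} (hT : IsSelfAdjoint T) : chi T * T = T * chi T := by
  rw [← chi_mul_modulus hT, ← modulus_mul_chi hT, chi_commute_modulus hT]

theorem one_sub_chi_mul_modulus {T : N} (hT : IsSelfAdjoint T) :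
    (1 - chi T) * modulus T = -((1 - chi T) * T) := by
  have h := chi_mul_modulus_add_self hT
  rw [eq_neg_iff_add_eq_zero, ← mul_add, sub_mul, h, one_mul, sub_self]

theorem modulus_mul_one_sub_chi {T : N} (hT : IsSelfAdjoint T) :
    modulus T * (1 - chi T) = -((1 - chi T) * T) := by
  rw [← one_sub_chi_mul_modulus hT, mul_sub, sub_mul, mul_one, one_mul, chi_commute_modulus hT]

theorem qnorm_smul_one_sub_modulus_le (T : N) {c : ℝ} (hc : ‖modulus T‖ ≤ c) :
    qnorm J ((c : ℂ) • (1 : N) - modulus T) ≤ c - 0 := by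
  rw [sub_zero]
  exact (qnorm_le J _).trans (norm_smul_one_sub_modulus_le T hc)

/-- Near a self-adjoint Fredholm operator the spectral projection is Lipschitz modulo `J`. -/
theorem exists_qnorm_chi_sub_le (hJ : IsClosed (J : Set N)) (T : FredholmSA J) :
    ∃ δ : ℝ, 0 < δ ∧ ∀ T' : FredholmSA J,
      δ * qnorm J (chi T.1 - chi T'.1) ≤ 2 * qnorm J (T.1 - T'.1) := by
  obtain ⟨T, hT, hu⟩ := T
  obtain ⟨S0, hS0⟩ := hu.exists_left_inv
  obtain ⟨S, rfl⟩ := Ideal.Quotient.mk_surjective S0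
  rw [← map_mul, ← map_one (Ideal.Quotient.mk J), Ideal.Quotient.eq] at hS0
  have hS1 : S * (chi T + chi T - 1) * modulus T - 1 ∈ J := by
    rwa [mul_assoc, ← self_eq_symmetry_mul_modulus hT]
  obtain ⟨δ, hδ, M, hM⟩ := exists_modulus_gap hJ T _ hS1
  refine ⟨δ, hδ, ?_⟩
  rintro ⟨T', hT', -⟩
  change δ * qnorm J (chi T - chi T') ≤ 2 * qnorm J (T - T')
  set c := max 1 (max M ‖modulus T'‖) with hc
  have hc0 : 0 < c := lt_of_lt_of_le one_pos (le_max_left _ _)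
  have hg := hM c ((le_max_left _ _).trans (le_max_right _ _))
  have hg' := qnorm_smul_one_sub_modulus_le (J := J) T'
    (show ‖modulus T'‖ ≤ c from (le_max_right _ _).trans (le_max_right _ _))
  have hP := qnorm_le_one_of_isStarProjection (J := J) (isStarProjection_chi T)
  have hP' := qnorm_le_one_of_isStarProjection (J := J) (isStarProjection_chi T')
  have hQ := qnorm_le_one_of_isStarProjection (J := J) (isStarProjection_chi T).one_sub
  have hQ' := qnorm_le_one_of_isStarProjection (J := J) (isStarProjection_chi T').one_sub
  have hcc' := chi_commute_self hT'
  -- |T| acts as T on the range of χ(T), while |T'| acts as -T' on the range of 1 - χ(T'); this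
  -- produces the difference T - T'. Only |T| needs a gap, so δ does not depend on T'.
  have h1 : modulus T * (chi T * (1 - chi T')) + chi T * (1 - chi T') * modulus T' =
      chi T * (T - T') * (1 - chi T') := by
    rw [← mul_assoc, ← chi_commute_modulus hT, chi_mul_modulus hT, mul_assoc (chi T) (1 - chi T'),
      one_sub_chi_mul_modulus hT', sub_mul 1, hcc']
    noncomm_ring
  have h2 : modulus T * ((1 - chi T) * chi T') + (1 - chi T) * chi T' * modulus T' =
      -((1 - chi T) * (T - T') * chi T') := by
    rw [← mul_assoc, modulus_mul_one_sub_chi hT, mul_assoc (1 - chi T) (chi T'),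
      chi_mul_modulus hT', hcc']
    noncomm_ring
  have h3 := qnorm_le_of_sylvester hc0 hg hg' h1
  have h4 := qnorm_le_of_sylvester hc0 hg hg' h2
  rw [add_zero] at h3 h4
  rw [qnorm_neg] at h4
  have h5 := (qnorm_mul_le_of_right_le_one hQ' _).trans
    (qnorm_mul_le_of_left_le_one hP (T - T'))
  have h6 := (qnorm_mul_le_of_right_le_one hP' _).trans
    (qnorm_mul_le_of_left_le_one hQ (T - T'))
  have h7 : chi T - chi T' = chi T * (1 - chi T') + -((1 - chi T) * chi T') := by noncomm_ring
  have h8 := qnorm_add_le J (chi T * (1 - chi T')) (-((1 - chi T) * chi T'))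
  rw [← h7, qnorm_neg] at h8
  nlinarith

theorem qnorm_chi_sub_eq_zero (hJ : IsClosed (J : Set N)) {S T : FredholmSA J}
    (h : S.1 - T.1 ∈ J) : qnorm J (chi S.1 - chi T.1) = 0 := by
  obtain ⟨δ, hδ, h1⟩ := exists_qnorm_chi_sub_le hJ S
  have h2 := h1 T
  rw [qnorm_of_mem h, mul_zero] at h2
  exact le_antisymm (nonpos_of_mul_nonpos_right h2 hδ) (qnorm_nonneg J _)

/-- χ jumps at 0, so χ(T) itself need not vary continuously; modulo `J` the gap of `T` around 0
repairs this. -/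
theorem continuous_mk_chi (hJ : IsClosed (J : Set N)) :
    Continuous fun T : FredholmSA J => Ideal.Quotient.mk J (chi T.1) := by
  rw [continuous_iff_continuousAt]
  intro T
  obtain ⟨δ, hδ, h⟩ := exists_qnorm_chi_sub_le hJ T
  rw [ContinuousAt, tendsto_iff_norm_sub_tendsto_zero]
  have hlim : Filter.Tendsto (fun T' : FredholmSA J => 2 / δ * ‖T.1 - T'.1‖) (nhds T)
      (nhds 0) := by
    have hc : Continuous fun T' : FredholmSA J => 2 / δ * ‖T.1 - T'.1‖ := by fun_prop
    simpa using hc.tendsto T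
  refine squeeze_zero (fun _ => norm_nonneg _) (fun T' => ?_) hlim
  rw [← map_sub]
  change qnorm J (chi T'.1 - chi T.1) ≤ _
  rw [qnorm_sub_rev, div_mul_eq_mul_div, le_div_iff₀' hδ]
  exact (h T').trans (mul_le_mul_of_nonneg_left (qnorm_le J _) zero_le_two)

end SpectralProjection

/-! ### Two projections and the sign of p + q - 1. -/

section TwoProjections

variable {H : Type*} [NormedAddCommGroup H] [InnerProductSpace ℂ H] [CompleteSpace H]
  {N : VonNeumannAlgebra H} {J : Ideal N} [J.IsTwoSided]

theorem kerProj_mul_of_mul_eq_zero {S x : N} (h : S * x = 0) : kerProj S * x = x := by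
  refine Subtype.ext (ContinuousLinearMap.ext fun v => ?_)
  refine Submodule.starProjection_eq_self_iff.2 (Submodule.le_topologicalClosure _ ?_)
  exact congrArg (fun f : N => (f : H →L[ℂ] H) v) h

theorem mul_kerProj (S : N) : S * kerProj S = 0 :=
  Subtype.ext (ContinuousLinearMap.ext fun v => mem_range_kerProj S _ ⟨v, rfl⟩)

theorem star_kerProj (S : N) : star (kerProj S) = kerProj S :=
  Subtype.ext (isStarProjection_starProjection (U := _)).isSelfAdjoint.star_eq

/-- An element vanishing on the range and on the kernel of a self-adjoint `D` is zero. -/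
theorem eq_zero_of_mul_eq_zero_of_mul_kerProj {D K : N} (hD : IsSelfAdjoint D) (h : K * D = 0)
    (h' : K * kerProj D = 0) : K = 0 := by
  have h1 := congrArg star h
  rw [star_mul, hD.star_eq, star_zero] at h1
  have h2 := congrArg star (kerProj_mul_of_mul_eq_zero h1)
  rwa [star_mul, star_star, star_kerProj, h', eq_comm] at h2

theorem infProj_mul {p q x : N} (hp : p * x = x) (hq : q * x = x) : infProj p q * x = x := by
  refine Subtype.ext (ContinuousLinearMap.ext fun v => ?_)
  refine Submodule.starProjection_eq_self_iff.2 (Submodule.le_topologicalClosure _ ⟨?_, ?_⟩)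
  · exact ⟨(x : H →L[ℂ] H) v, congrArg (fun f : N => (f : H →L[ℂ] H) v) hp⟩
  · exact ⟨(x : H →L[ℂ] H) v, congrArg (fun f : N => (f : H →L[ℂ] H) v) hq⟩

theorem left_mul_infProj {p : N} (hp : IsIdempotentElem p) (q : N) :
    p * infProj p q = infProj p q := by
  simpa using mul_infProj p q p 1 fun x hx _ => apply_of_mem_range p hp x hx

theorem right_mul_infProj (p : N) {q : N} (hq : IsIdempotentElem q) :
    q * infProj p q = infProj p q := by
  simpa using mul_infProj p q q 1 fun x _ hx => apply_of_mem_range q hq x hx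

theorem infProj_mul_right {p q : N} (hq : IsStarProjection q) : infProj p q * q = infProj p q := by
  have h := congrArg star (right_mul_infProj p hq.isIdempotentElem)
  rwa [star_mul, hq.isSelfAdjoint.star_eq, star_infProj] at h

theorem mul_infProj_one_sub (p : N) {q : N} (hq : IsIdempotentElem q) :
    q * infProj (1 - q) p = 0 := by
  have h := left_mul_infProj hq.one_sub p
  rw [sub_mul, one_mul] at h
  exact sub_eq_self.1 h

theorem infProj_one_sub_mul (p : N) {q : N} (hq : IsStarProjection q) :
    infProj (1 - q) p * q = 0 := by
  have h := congrArg star (mul_infProj_one_sub p hq.isIdempotentElem)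
  rwa [star_mul, hq.isSelfAdjoint.star_eq, star_infProj, star_zero] at h

/-- The symmetry `sgn(p + q - 1)` (with value `1` on the kernel). -/
def swapSymm (p q : N) : N := chi (p + q - 1) + chi (p + q - 1) - 1

variable {p q : N}

theorem star_swapSymm (p q : N) : star (swapSymm p q) = swapSymm p q := by
  unfold swapSymm
  rw [star_sub, star_add, star_one, (isStarProjection_chi _).isSelfAdjoint.star_eq]

theorem swapSymm_mul_self (p q : N) : swapSymm p q * swapSymm p q = 1 := by
  have h := (isStarProjection_chi (p + q - 1)).isIdempotentElem.eq
  unfold swapSymm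
  have e : (chi (p + q - 1) + chi (p + q - 1) - 1) * (chi (p + q - 1) + chi (p + q - 1) - 1) =
    4 • (chi (p + q - 1) * chi (p + q - 1)) - 4 • chi (p + q - 1) + 1 := by noncomm_ring
  rw [e, h, sub_self, zero_add]

theorem isSelfAdjoint_add_sub_one (hp : IsStarProjection p) (hq : IsStarProjection q) :
    IsSelfAdjoint (p + q - 1) :=
  (hp.isSelfAdjoint.add hq.isSelfAdjoint).sub (.one N)

theorem add_sub_one_mul (hp : IsIdempotentElem p) : (p + q - 1) * p = q * p := by
  rw [sub_mul, add_mul, hp.eq, one_mul]; abel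

theorem mul_add_sub_one (hp : IsIdempotentElem p) : p * (p + q - 1) = p * q := by
  rw [mul_sub, mul_add, hp.eq, mul_one]; abel

theorem add_sub_one_mul' (hq : IsIdempotentElem q) : (p + q - 1) * q = p * q := by
  rw [sub_mul, add_mul, hq.eq, one_mul]; abel

theorem mul_add_sub_one' (hq : IsIdempotentElem q) : q * (p + q - 1) = q * p := by
  rw [mul_sub, mul_add, hq.eq, mul_one]; abel

/-- (p + q - 1)²p = pqp = p(p + q - 1)², and symmetrically for `q`; the square root inherits the
commutation. -/
theorem modulus_add_sub_one_commute (hp : IsStarProjection p) (hq : IsStarProjection q) :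
    modulus (p + q - 1) * p = p * modulus (p + q - 1) ∧
      modulus (p + q - 1) * q = q * modulus (p + q - 1) := by
  have h := (isSelfAdjoint_add_sub_one hp hq).star_eq
  constructor <;> refine modulus_commute ?_ <;> rw [h]
  · rw [mul_assoc, add_sub_one_mul hp.isIdempotentElem, ← mul_assoc,
      add_sub_one_mul' hq.isIdempotentElem, ← mul_assoc p, mul_add_sub_one hp.isIdempotentElem,
      mul_assoc p q p, mul_assoc p q, mul_add_sub_one' hq.isIdempotentElem]
  · rw [mul_assoc, add_sub_one_mul' hq.isIdempotentElem, ← mul_assoc,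
      add_sub_one_mul hp.isIdempotentElem, ← mul_assoc q, mul_add_sub_one' hq.isIdempotentElem,
      mul_assoc q p q, mul_assoc q p, mul_add_sub_one hp.isIdempotentElem]

theorem modulus_sq_mul (hp : IsStarProjection p) (hq : IsStarProjection q) :
    modulus (p + q - 1) * modulus (p + q - 1) * p = p * q * p := by
  rw [modulus_mul_self, (isSelfAdjoint_add_sub_one hp hq).star_eq, mul_assoc,
    add_sub_one_mul hp.isIdempotentElem, ← mul_assoc, add_sub_one_mul' hq.isIdempotentElem]

theorem swapSymm_mul_add_sub_one (hp : IsStarProjection p) (hq : IsStarProjection q) :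
    swapSymm p q * (p + q - 1) = modulus (p + q - 1) := by
  conv_lhs => rw [self_eq_symmetry_mul_modulus (isSelfAdjoint_add_sub_one hp hq)]
  change swapSymm p q * (swapSymm p q * _) = _
  rw [← mul_assoc, swapSymm_mul_self, one_mul]

theorem swapSymm_mul_modulus (hp : IsStarProjection p) (hq : IsStarProjection q) :
    swapSymm p q * modulus (p + q - 1) = p + q - 1 :=
  (self_eq_symmetry_mul_modulus (isSelfAdjoint_add_sub_one hp hq)).symm

/-- Tx = 0 forces |T|x = 0 by the C*-identity, hence T⁻x = 0 since 2T⁻ = |T| - T. -/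
theorem chi_mul_of_mul_eq_zero {T x : N} (hT : IsSelfAdjoint T) (h : T * x = 0) :
    chi T * x = x := by
  have h1 : modulus T * x = 0 := by
    have h2 : star (modulus T * x) * (modulus T * x) = 0 := by
      rw [star_mul, star_modulus, mul_assoc, ← mul_assoc (modulus T), modulus_mul_self, mul_assoc,
        h, mul_zero, mul_zero]
    refine Subtype.ext ?_
    have h3 : star ((modulus T * x : N) : H →L[ℂ] H) * ((modulus T * x : N) : H →L[ℂ] H) = 0 :=
      congrArg Subtype.val h2
    exact (CStarRing.star_mul_self_eq_zero_iff _).1 h3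
  have hT' : IsSelfAdjoint (T : H →L[ℂ] H) := congrArg Subtype.val hT
  refine chi_mul_apply _ _ fun v => ?_
  have h4 : (2 : ℕ) • (((T : H →L[ℂ] H)⁻) * (x : H →L[ℂ] H)) = 0 := by
    rw [← smul_mul_assoc, ← CFC.abs_sub_self _ hT']
    have : (modulus T - T) * x = 0 := by rw [sub_mul, h1, h, sub_zero]
    exact congrArg Subtype.val this
  have h5 : ((T : H →L[ℂ] H)⁻) * (x : H →L[ℂ] H) = 0 := by
    rw [two_smul, ← two_smul ℂ] at h4
    exact (smul_eq_zero.1 h4).resolve_left two_ne_zero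
  exact congrArg (fun f : H →L[ℂ] H => f v) h5

/-- The symmetry `sgn(p + q - 1)` intertwines the generic parts of `p` and `q`. -/
theorem swapSymm_intertwines (hp : IsStarProjection p) (hq : IsStarProjection q) :
    swapSymm p q * (p - infProj (1 - q) p) = (q - infProj (1 - p) q) * swapSymm p q := by
  set D := p + q - 1 with hD
  set e := infProj (1 - q) p with he
  set f := infProj (1 - p) q with hf
  have hDsa : IsSelfAdjoint D := isSelfAdjoint_add_sub_one hp hq
  have hpi := hp.isIdempotentElem
  have hqi := hq.isIdempotentElem
  have heq : e * q = 0 := infProj_one_sub_mul p hq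
  have hep : e * p = e := infProj_mul_right hp
  have hpf : p * f = 0 := mul_infProj_one_sub q hpi
  have hfq : f * q = f := infProj_mul_right hq
  have hqf : q * f = f := right_mul_infProj _ hqi
  have hUD : swapSymm p q * D = modulus D := swapSymm_mul_add_sub_one hp hq
  rw [← sub_eq_zero]
  -- Test on ran D and on ker D separately. On ran D both sides become |D|q, because pD = Dq, UD =
  -- |D|, and `e`, `f` are annihilated by D. On ker D one has pn = en and qn = fn, so both sides
  -- vanish.
  refine eq_zero_of_mul_eq_zero_of_mul_kerProj hDsa ?_ ?_
  · have heD : e * D = 0 := by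
      rw [hD, mul_sub, mul_add, hep, heq, mul_one, add_zero, sub_self]
    have hDf : D * f = 0 := by
      rw [hD, sub_mul, add_mul, hpf, hqf, one_mul, zero_add, sub_self]
    have hAf : modulus D * f = 0 := by rw [← hUD, mul_assoc, hDf, mul_zero]
    have hfA : f * modulus D = 0 := by
      have h := congrArg star hAf
      rwa [star_mul, star_modulus, star_infProj, star_zero] at h
    have hpD : p * D = D * q := by
      rw [hD, mul_add_sub_one hpi, add_sub_one_mul' hqi]
    rw [sub_mul, mul_assoc, sub_mul p, heD, sub_zero, hpD, ← mul_assoc, hUD, mul_assoc, hUD,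
      sub_mul, hfA, sub_zero, (modulus_add_sub_one_commute hp hq).2, sub_self]
  · set n := kerProj D with hn
    have hDn : D * n = 0 := mul_kerProj D
    have hUn : swapSymm p q * n = n := by
      change (chi D + chi D - 1) * n = n
      rw [sub_mul, add_mul, chi_mul_of_mul_eq_zero hDsa hDn, one_mul, add_sub_cancel_right]
    have hqpn : q * (p * n) = 0 := by
      rw [← mul_assoc, ← mul_add_sub_one' hqi, mul_assoc, hDn, mul_zero]
    have hpqn : p * (q * n) = 0 := by
      rw [← mul_assoc, ← mul_add_sub_one hpi, mul_assoc, hDn, mul_zero]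
    have hen : e * n = p * n := by
      rw [← hep, mul_assoc]
      refine infProj_mul ?_ ?_
      · rw [sub_mul, one_mul, hqpn, sub_zero]
      · rw [← mul_assoc, hpi.eq]
    have hfn : f * n = q * n := by
      rw [← hfq, mul_assoc]
      refine infProj_mul ?_ ?_
      · rw [sub_mul, one_mul, hpqn, sub_zero]
      · rw [← mul_assoc, hqi.eq]
    rw [sub_mul, mul_assoc, mul_assoc, hUn, sub_mul p, hen, sub_self, sub_mul q, hfn, sub_self,
      mul_zero, sub_zero]

end TwoProjections

/-! ### Generalized inverses between corners, with explicit defects. -/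

section PartialIsometry

variable {H : Type*} [NormedAddCommGroup H] [InnerProductSpace ℂ H] [CompleteSpace H]
  {N : VonNeumannAlgebra H} {J : Ideal N} [J.IsTwoSided]

/-- Generalized inverses `a ∈ qNp` and `b ∈ pNq` with defects `e = p - ba`, `f = q - ab` which are
idempotents in `J`. -/
structure IsCornerIso (J : Ideal N) (p q a b e f : N) : Prop where
  mul_left : q * a = a
  mul_right : a * p = a
  inv_mul_left : p * b = b
  inv_mul_right : b * q = b
  inv_mul_self : b * a = p - e
  mul_inv_self : a * b = q - f
  mul_defect : a * e = 0
  defect_mul : f * a = 0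
  inv_mul_defect : b * f = 0
  defect_mul_inv : e * b = 0
  defect_idem : IsIdempotentElem e
  codefect_idem : IsIdempotentElem f
  left_mul_defect : p * e = e
  defect_mul_left : e * p = e
  left_mul_codefect : q * f = f
  codefect_mul_left : f * q = f
  defect_mem : e ∈ J
  codefect_mem : f ∈ J

variable {p q r : N}

theorem infProj_one_sub_mem (hJ : IsClosed (J : Set N)) (hp : IsStarProjection p)
    (hq : IsStarProjection q) (h : qnorm J (p - q) < 1) :
    infProj (1 - q) p ∈ J ∧ infProj (1 - p) q ∈ J := by
  have h' := h
  rw [qnorm_sub_rev] at h'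
  unfold qnorm at h h'
  rw [map_sub] at h h'
  exact ⟨mem_of_norm_lt_one hJ hp hq h, mem_of_norm_lt_one hJ hq hp h'⟩

/-- The partial isometry from the generic part of `p` to the generic part of `q`. -/
def genericIso (p q : N) : N := swapSymm p q * (p - infProj (1 - q) p)

theorem star_genericIso (hp : IsStarProjection p) :
    star (genericIso p q) = (p - infProj (1 - q) p) * swapSymm p q := by
  unfold genericIso
  rw [star_mul, star_sub, star_swapSymm, hp.isSelfAdjoint.star_eq, star_infProj]

theorem sub_infProj_mul_self (hp : IsStarProjection p) :
    (p - infProj (1 - q) p) * (p - infProj (1 - q) p) = p - infProj (1 - q) p := by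
  rw [sub_mul, mul_sub, mul_sub, hp.isIdempotentElem.eq, right_mul_infProj _ hp.isIdempotentElem,
    infProj_mul_right hp, (isIdempotentElem_infProj _ _).eq, sub_self, sub_zero]

/-- All relations follow from U² = 1 and the intertwining U(p - e) = (q - f)U. Closeness of `p` and
`q` enters only to put both defects in `J`. -/
theorem isCornerIso_genericIso (hJ : IsClosed (J : Set N)) (hp : IsStarProjection p)
    (hq : IsStarProjection q) (h : qnorm J (p - q) < 1) :
    IsCornerIso J p q (genericIso p q) (star (genericIso p q)) (infProj (1 - q) p)
      (infProj (1 - p) q) := by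
  have hpi := hp.isIdempotentElem
  have hqi := hq.isIdempotentElem
  have hpe := right_mul_infProj (1 - q) hpi
  have hep : infProj (1 - q) p * p = infProj (1 - q) p := infProj_mul_right hp
  have hqf := right_mul_infProj (1 - p) hqi
  have hfq : infProj (1 - p) q * q = infProj (1 - p) q := infProj_mul_right hq
  have hee := (isIdempotentElem_infProj (1 - q) p).eq
  have hff := (isIdempotentElem_infProj (1 - p) q).eq
  have hint := swapSymm_intertwines hp hq
  have hint' := congrArg star hint
  rw [star_mul, star_mul, star_sub, star_sub, star_swapSymm, star_infProj, star_infProj,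
    hp.isSelfAdjoint.star_eq, hq.isSelfAdjoint.star_eq] at hint'
  have hUU := swapSymm_mul_self p q
  have hmem := infProj_one_sub_mem hJ hp hq h
  have hs := star_genericIso (q := q) hp
  refine ⟨?_, ?_, ?_, ?_, ?_, ?_, ?_, ?_, ?_, ?_, hee, hff, hpe, hep, hqf, hfq, hmem.1, hmem.2⟩
  · unfold genericIso
    rw [hint, ← mul_assoc, mul_sub, hqi.eq, hqf]
  · unfold genericIso
    rw [mul_assoc, sub_mul, hpi.eq, hep]
  · rw [hs, ← mul_assoc, mul_sub, hpi.eq, hpe]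
  · rw [hs, hint', mul_assoc, sub_mul, hqi.eq, hfq]
  · rw [hs, genericIso, mul_assoc, ← mul_assoc (swapSymm p q), hUU, one_mul,
      sub_infProj_mul_self hp]
  · rw [hs, genericIso, mul_assoc, ← mul_assoc (p - infProj (1 - q) p), sub_infProj_mul_self hp,
      hint', ← mul_assoc, hUU, one_mul]
  · unfold genericIso
    rw [mul_assoc, sub_mul, hpe, hee, sub_self, mul_zero]
  · unfold genericIso
    rw [hint, ← mul_assoc, mul_sub, hfq, hff, sub_self, zero_mul]
  · rw [hs, hint', mul_assoc, sub_mul, hqf, hff, sub_self, mul_zero]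
  · rw [hs, ← mul_assoc, mul_sub, hep, hee, sub_self, zero_mul]

/-- Precomposing with an invertible of `pNp` conjugates the defect on the `p` side and leaves the
other one alone. -/
theorem IsCornerIso.comp_right {a b e f g g' : N} (h : IsCornerIso J p q a b e f)
    (h2 : g * p = g) (h3 : p * g' = g')
    (h4 : g' * p = g') (h5 : g * g' = p) (h6 : g' * g = p) :
    IsCornerIso J p q (a * g) (g' * b) (g' * e * g) f where
  mul_left := by rw [← mul_assoc, h.mul_left]
  mul_right := by rw [mul_assoc, h2]
  inv_mul_left := by rw [← mul_assoc, h3]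
  inv_mul_right := by rw [mul_assoc, h.inv_mul_right]
  inv_mul_self := by
    have : g' * b * (a * g) = g' * (b * a) * g := by noncomm_ring
    rw [this, h.inv_mul_self, mul_sub, h4, sub_mul, h6]
  mul_inv_self := by
    have : a * g * (g' * b) = a * (g * g') * b := by noncomm_ring
    rw [this, h5, h.mul_right, h.mul_inv_self]
  mul_defect := by
    have : a * g * (g' * e * g) = a * (g * g') * e * g := by noncomm_ring
    rw [this, h5, h.mul_right, h.mul_defect, zero_mul]
  defect_mul := by rw [← mul_assoc, h.defect_mul, zero_mul]
  inv_mul_defect := by rw [mul_assoc, h.inv_mul_defect, mul_zero]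
  defect_mul_inv := by
    have : g' * e * g * (g' * b) = g' * (e * ((g * g') * b)) := by noncomm_ring
    rw [this, h5, h.inv_mul_left, h.defect_mul_inv, mul_zero]
  defect_idem := by
    have : g' * e * g * (g' * e * g) = g' * (e * (g * g') * e) * g := by noncomm_ring
    unfold IsIdempotentElem
    rw [this, h5, h.defect_mul_left, h.defect_idem.eq]
  codefect_idem := h.codefect_idem
  left_mul_defect := by rw [← mul_assoc, ← mul_assoc, h3]
  defect_mul_left := by rw [mul_assoc, h2]
  left_mul_codefect := h.left_mul_codefect
  codefect_mul_left := h.codefect_mul_left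
  defect_mem := J.mul_mem_right _ (J.mul_mem_left _ h.defect_mem)
  codefect_mem := h.codefect_mem

end PartialIsometry

/-! ### Quantitative estimates modulo `J`. -/

section Estimates

variable {H : Type*} [NormedAddCommGroup H] [InnerProductSpace ℂ H] [CompleteSpace H]
  {N : VonNeumannAlgebra H} {J : Ideal N} [J.IsTwoSided] {p q r : N}

theorem qnorm_mul_one_sub_le (p : N) (hq : IsStarProjection q) :
    qnorm J (p * (1 - q)) ≤ qnorm J (p - q) := by
  have : p * (1 - q) = (p - q) * (1 - q) := by
    rw [sub_mul, mul_sub q, hq.isIdempotentElem.eq, mul_one, sub_self, sub_zero]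
  rw [this]
  exact qnorm_mul_le_of_right_le_one (qnorm_le_one_of_isStarProjection hq.one_sub) _

theorem qnorm_one_sub_mul_le (p : N) (hq : IsStarProjection q) :
    qnorm J ((1 - q) * p) ≤ qnorm J (p - q) := by
  have : (1 - q) * p = (1 - q) * (p - q) := by
    rw [mul_sub, sub_mul _ _ q, hq.isIdempotentElem.eq, one_mul, sub_self, sub_zero]
  rw [this]
  exact qnorm_mul_le_of_left_le_one (qnorm_le_one_of_isStarProjection hq.one_sub) _

theorem qnorm_sub_compress_le (hp : IsStarProjection p) (hq : IsStarProjection q) :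
    qnorm J (p - p * q * p) ≤ qnorm J (p - q) * qnorm J (p - q) := by
  have : p - p * q * p = (p * (1 - q)) * ((1 - q) * p) := by
    have e : (p * (1 - q)) * ((1 - q) * p) = p * p - p * q * p - p * q * p + p * (q * q) * p := by
      noncomm_ring
    rw [e, hp.isIdempotentElem.eq, hq.isIdempotentElem.eq]
    abel
  rw [this]
  exact (qnorm_mul_le J _ _).trans (mul_le_mul (qnorm_mul_one_sub_le p hq)
    (qnorm_one_sub_mul_le p hq) (qnorm_nonneg J _) (qnorm_nonneg J _))

/-- `pqp` lies within ‖π(p - q)‖² < 1 of `p` modulo `J`, so it agrees modulo `J` with an invertible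
of the corner, whose inverse supplies the left parametrix; exchanging `p` and `q` gives the right
one. -/
theorem isRelFredholm_mul (hp : IsStarProjection p) (hq : IsStarProjection q)
    (h : qnorm J (p - q) < 1) : IsRelFredholm J q p (q * p) := by
  have hpi := hp.isIdempotentElem
  have hqi := hq.isIdempotentElem
  have key : ∀ {p q : N}, IsStarProjection p → IsStarProjection q → qnorm J (p - q) < 1 →
      ∃ g g' : N, g - p * q * p ∈ J ∧ p * g = g ∧ g * p = g ∧ p * g' = g' ∧ g' * p = g' ∧
        g * g' = p ∧ g' * g = p := by
    intro p q hp hq h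
    have hpi := hp.isIdempotentElem
    refine exists_corner_inverse hpi ?_ ?_ ?_ (norm_le_one_of_isStarProjection hp)
    · rw [← mul_assoc, ← mul_assoc, hpi.eq]
    · rw [mul_assoc, hpi.eq]
    · refine (qnorm_sub_compress_le hp hq).trans_lt ?_
      nlinarith [qnorm_nonneg J (p - q)]
  obtain ⟨g, g', hg, -, -, hpg', hg'p, -, hg'g⟩ := key hp hq h
  obtain ⟨k, k', hk, -, -, hqk', hk'q, hkk', -⟩ := key hq hp ((qnorm_sub_rev J q p).trans_lt h)
  refine ⟨?_, g' * (p * q), p * q * k', ?_, ?_, ?_, ?_⟩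
  · rw [← mul_assoc, hqi.eq, mul_assoc, hpi.eq]
  · rw [← mul_assoc p, hpg', mul_assoc, mul_assoc, hqi.eq]
  · rw [← mul_assoc, ← mul_assoc, hpi.eq, mul_assoc (p * q), hk'q]
  · rw [Ideal.Quotient.eq]
    have : g' * (p * q) * (q * p) - p = -(g' * (g - p * q * p)) := by
      have e : g' * (p * q) * (q * p) = g' * (p * (q * q) * p) := by noncomm_ring
      rw [e, hqi.eq, mul_sub, hg'g]; abel
    rw [this]
    exact J.neg_mem (J.mul_mem_left _ hg)
  · rw [Ideal.Quotient.eq]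
    have : q * p * (p * q * k') - q = -((k - q * p * q) * k') := by
      have e : q * p * (p * q * k') = q * (p * p) * q * k' := by noncomm_ring
      rw [e, hpi.eq, sub_mul, hkk']; abel
    rw [this]
    exact J.neg_mem (J.mul_mem_right _ hk)

theorem qnorm_sub_modulus_mul_le (hp : IsStarProjection p) (hq : IsStarProjection q)
    (h : qnorm J (p - q) < 1 / 2) :
    qnorm J (p - modulus (p + q - 1) * p) ≤ 1 / 7 := by
  set A := modulus (p + q - 1) with hA
  set y := p - A * p with hy
  have hpi := hp.isIdempotentElem
  have hcomm : A * p = p * A := (modulus_add_sub_one_commute hp hq).1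
  have hsq : A * A * p = p * q * p := modulus_sq_mul hp hq
  have hz : qnorm J (p - p * q * p) ≤ 1 / 4 := by
    refine (qnorm_sub_compress_le hp hq).trans ?_
    nlinarith [qnorm_nonneg J (p - q)]
  -- Since A²p = pqp, (1 + A)(p - Ap) = p - pqp. The Sylvester bound with A ≥ 0 and the coefficient
  -- 1 gives ‖y‖ ≤ 1/4 in the quotient.
  have h1 : A * y + y * 1 = p - p * q * p := by
    rw [hy, mul_sub, mul_one, ← mul_assoc, hsq]; abel
  have hbound : ‖A‖ ≤ max ‖A‖ 1 := le_max_left _ _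
  have hc1 : 1 ≤ max ‖A‖ 1 := le_max_right _ _
  have hone : qnorm J (((max ‖A‖ 1 : ℝ) : ℂ) • (1 : N) - 1) ≤ max ‖A‖ 1 - 1 := by
    have e : ((max ‖A‖ 1 : ℝ) : ℂ) • (1 : N) - 1 = ((max ‖A‖ 1 - 1 : ℝ) : ℂ) • (1 : N) := by
      rw [Complex.ofReal_sub, sub_smul, Complex.ofReal_one, one_smul]
    rw [e]
    refine (qnorm_smul_le _ _).trans ?_
    rw [abs_of_nonneg (sub_nonneg.2 hc1)]
    exact mul_le_of_le_one_right (sub_nonneg.2 hc1)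
      (qnorm_le_one_of_isStarProjection (.one N))
  have h2 := qnorm_le_of_sylvester (by positivity) (qnorm_smul_one_sub_modulus_le _ hbound) hone h1
  rw [zero_add, one_mul] at h2
  -- Bootstrapping: 2‖y‖ ≤ ‖y‖² + 1/4 ≤ ‖y‖/4 + 1/4 improves 1/4 to 1/7. The cruder value would not
  -- suffice for the triangle estimate.
  have h3 : ((2 : ℝ) : ℂ) • y = y * y + (p - p * q * p) := by
    have e : y * y = p * p - p * A * p - A * (p * p) + A * (p * A) * p := by
      rw [hy]; noncomm_ring
    rw [e, ← hcomm, hpi.eq, mul_assoc A p p, hpi.eq, ← mul_assoc, hsq, mul_assoc (p * q), hpi.eq,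
      Complex.ofReal_ofNat, two_smul, hy]
    abel
  have h4 := congrArg (qnorm J) h3
  rw [qnorm_smul two_pos] at h4
  have h5 := qnorm_add_le J (y * y) (p - p * q * p)
  have h6 := qnorm_mul_le J y y
  nlinarith [qnorm_nonneg J y]

theorem qnorm_swapSymm_le_one (p q : N) : qnorm J (swapSymm p q) ≤ 1 :=
  (qnorm_le J _).trans (norm_le_one_of_unitary (star_swapSymm p q) (swapSymm_mul_self p q))

theorem qnorm_genericIso_sub_le (hJ : IsClosed (J : Set N)) (hp : IsStarProjection p)
    (hq : IsStarProjection q) (h : qnorm J (p - q) < 1 / 2) :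
    qnorm J (genericIso p q - q * p) ≤ 1 / 7 ∧
      qnorm J (star (genericIso p q) - p * q) ≤ 1 / 7 := by
  have hmem := (infProj_one_sub_mem hJ hp hq (h.trans (by norm_num))).1
  have hA := qnorm_sub_modulus_mul_le hp hq h
  have hU := qnorm_swapSymm_le_one (J := J) p q
  have hpi := hp.isIdempotentElem
  have h1 : swapSymm p q * (modulus (p + q - 1) * p) = q * p := by
    rw [← mul_assoc, swapSymm_mul_modulus hp hq, add_sub_one_mul hpi]
  have h2 : modulus (p + q - 1) * p * swapSymm p q = p * q := by
    have e := congrArg star h1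
    rwa [star_mul, star_mul, star_mul, star_swapSymm, star_modulus, hp.isSelfAdjoint.star_eq,
      hq.isSelfAdjoint.star_eq, ← (modulus_add_sub_one_commute hp hq).1] at e
  constructor
  · refine (qnorm_congr (y := swapSymm p q * (p - modulus (p + q - 1) * p)) ?_).trans_le
      ((qnorm_mul_le_of_left_le_one hU _).trans hA)
    have : genericIso p q - q * p - swapSymm p q * (p - modulus (p + q - 1) * p) =
        -(swapSymm p q * infProj (1 - q) p) := by
      rw [genericIso, mul_sub, mul_sub, h1]; abel
    rw [this]
    exact J.neg_mem (J.mul_mem_left _ hmem)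
  · refine (qnorm_congr (y := (p - modulus (p + q - 1) * p) * swapSymm p q) ?_).trans_le
      ((qnorm_mul_le_of_right_le_one hU _).trans hA)
    have : star (genericIso p q) - p * q - (p - modulus (p + q - 1) * p) * swapSymm p q =
        -(infProj (1 - q) p * swapSymm p q) := by
      rw [star_genericIso hp, sub_mul, sub_mul, h2]; abel
    rw [this]
    exact J.neg_mem (J.mul_mem_right _ hmem)

theorem qnorm_genericIso_le_one (hJ : IsClosed (J : Set N)) (hp : IsStarProjection p)
    (hq : IsStarProjection q) (h : qnorm J (p - q) < 1) : qnorm J (genericIso p q) ≤ 1 := by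
  refine (qnorm_mul_le_of_left_le_one (qnorm_swapSymm_le_one p q) _).trans ?_
  refine (qnorm_congr (y := p) ?_).trans_le (qnorm_le_one_of_isStarProjection hp)
  rw [sub_sub_cancel_left]
  exact J.neg_mem (infProj_one_sub_mem hJ hp hq h).1

/-- The triangle of partial isometries commutes up to a small error modulo `J`. -/
theorem qnorm_sub_triangle_lt_one (hJ : IsClosed (J : Set N)) (hp : IsStarProjection p)
    (hq : IsStarProjection q) (hr : IsStarProjection r) (hpq : qnorm J (p - q) < 1 / 2)
    (hqr : qnorm J (q - r) < 1 / 2) (hpr : qnorm J (p - r) < 1 / 2) :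
    qnorm J (p - star (genericIso p r) * genericIso q r * genericIso p q) < 1 := by
  have hhalf : (1 / 2 : ℝ) < 1 := by norm_num
  set v := genericIso p q
  set w := genericIso q r
  set u := star (genericIso p r)
  have hv := (qnorm_genericIso_sub_le hJ hp hq hpq).1
  have hw := (qnorm_genericIso_sub_le hJ hq hr hqr).1
  have hu := (qnorm_genericIso_sub_le hJ hp hr hpr).2
  have hv1 := qnorm_genericIso_le_one hJ hp hq (hpq.trans hhalf)
  have hw1 := qnorm_genericIso_le_one hJ hq hr (hqr.trans hhalf)
  have hpn := qnorm_le_one_of_isStarProjection (J := J) hp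
  have hqn := qnorm_le_one_of_isStarProjection (J := J) hq
  have hrn := qnorm_le_one_of_isStarProjection (J := J) hr
  have hpi := hp.isIdempotentElem.eq
  have hqi := hq.isIdempotentElem.eq
  have hri := hr.isIdempotentElem.eq
  -- Pass from `p` to `prp`, then to `prqp`, then replace the factors `pr`, `rq`, `qp` by `u`, `w`,
  -- `v` one at a time.
  have h1 : p - u * w * v = (p - p * r * p) + p * ((r * (1 - q)) * ((1 - q) * p)) +
      -((u - p * r) * w * v) + -(p * (r * ((w - r * q) * v))) +
      -(p * (r * (q * (v - q * p)))) := by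
    have e1 : p * ((r * (1 - q)) * ((1 - q) * p)) =
        p * r * p - p * r * q * p - p * r * q * p + p * r * (q * q) * p := by noncomm_ring
    have e2 : p * (r * ((w - r * q) * v)) = p * r * w * v - p * (r * r) * q * v := by
      noncomm_ring
    have e3 : p * (r * (q * (v - q * p))) = p * r * q * v - p * r * (q * q) * p := by
      noncomm_ring
    rw [e1, e2, e3, hqi, hri]
    noncomm_ring
  have n1 : qnorm J (p - p * r * p) ≤ 1 / 4 := by
    refine (qnorm_sub_compress_le hp hr).trans ?_
    nlinarith [qnorm_nonneg J (p - r)]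
  have n2 : qnorm J (p * ((r * (1 - q)) * ((1 - q) * p))) ≤ 1 / 4 := by
    refine (qnorm_mul_le_of_left_le_one hpn _).trans ((qnorm_mul_le J _ _).trans ?_)
    have a1 := (qnorm_mul_one_sub_le (J := J) r hq)
    rw [qnorm_sub_rev] at a1
    have a2 := (qnorm_one_sub_mul_le (J := J) p hq)
    have a3 := qnorm_nonneg J (r * (1 - q))
    have a4 := qnorm_nonneg J ((1 - q) * p)
    nlinarith
  have n3 : qnorm J ((u - p * r) * w * v) ≤ 1 / 7 :=
    (qnorm_mul_le_of_right_le_one hv1 _).trans ((qnorm_mul_le_of_right_le_one hw1 _).trans hu)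
  have n4 : qnorm J (p * (r * ((w - r * q) * v))) ≤ 1 / 7 :=
    (qnorm_mul_le_of_left_le_one hpn _).trans ((qnorm_mul_le_of_left_le_one hrn _).trans
      ((qnorm_mul_le_of_right_le_one hv1 _).trans hw))
  have n5 : qnorm J (p * (r * (q * (v - q * p)))) ≤ 1 / 7 :=
    (qnorm_mul_le_of_left_le_one hpn _).trans ((qnorm_mul_le_of_left_le_one hrn _).trans
      ((qnorm_mul_le_of_left_le_one hqn _).trans hv))
  rw [h1]
  refine (qnorm_add_le J _ _).trans_lt ?_
  rw [qnorm_neg]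
  have m1 := qnorm_add_le J ((p - p * r * p) + p * ((r * (1 - q)) * ((1 - q) * p)) +
      -((u - p * r) * w * v)) (-(p * (r * ((w - r * q) * v))))
  have m2 := qnorm_add_le J ((p - p * r * p) + p * ((r * (1 - q)) * ((1 - q) * p)))
      (-((u - p * r) * w * v))
  have m3 := qnorm_add_le J (p - p * r * p) (p * ((r * (1 - q)) * ((1 - q) * p)))
  rw [qnorm_neg] at m1 m2
  -- The total is at most 1/4 + 1/4 + 3/7 = 13/14.
  linarith

end Estimates

/-! ### Classes of idempotent matrices in `K₀`. -/

section IdempotentClasses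

variable {R : Type*} [Ring R]

/-- The class in `V(R)` of an idempotent matrix. -/
def vClass {n : ℕ} (e : Matrix (Fin n) (Fin n) R) (he : IsIdempotentElem e) : VMon R :=
  Quotient.mk (idemSetoid R) (IdemMat.mk n e he)

/-- The class in `K₀(R)` of an idempotent matrix. -/
def idemClass {n : ℕ} (e : Matrix (Fin n) (Fin n) R) (he : IsIdempotentElem e) : K0U R :=
  Algebra.GrothendieckAddGroup.of (vClass e he)

theorem idemClass_congr {m n : ℕ} {e : Matrix (Fin m) (Fin m) R} {f : Matrix (Fin n) (Fin n) R}
    (he : IsIdempotentElem e) (hf : IsIdempotentElem f) (h : MatEquiv e f) :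
    idemClass e he = idemClass f hf :=
  congrArg Algebra.GrothendieckAddGroup.of (Quotient.sound h)

/-- The row (e f) and the column with entries `e`, `f` implement the equivalence of e + f with
diag(e, f). -/
theorem idemClass_add {n : ℕ} {e f g : Matrix (Fin n) (Fin n) R} (he : IsIdempotentElem e)
    (hf : IsIdempotentElem f) (hg : IsIdempotentElem g) (h : e + f = g) (hef : e * f = 0)
    (hfe : f * e = 0) : idemClass g hg = idemClass e he + idemClass f hf := by
  unfold idemClass
  rw [← map_add]
  refine congrArg Algebra.GrothendieckAddGroup.of ?_
  refine Quotient.sound (s := idemSetoid R) (a := IdemMat.mk n g hg)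
    (b := (IdemMat.mk n e he).dsum (IdemMat.mk n f hf)) ?_
  refine MatEquiv.trans hg (IdemMat.dsum _ _).idem ?_ (IdemMat.dsum_equiv _ _)
  refine ⟨Matrix.fromCols e f, Matrix.fromRows e f, ?_, ?_⟩
  · rw [Matrix.fromCols_mul_fromRows, he.eq, hf.eq, h]
  · rw [Matrix.fromRows_mul_fromCols, he.eq, hf.eq, hef, hfe]

theorem isIdempotentElem_diagonal {A : Type*} [NonUnitalRing A] {n : ℕ} {d : Fin n → A}
    (h : ∀ i, IsIdempotentElem (d i)) : IsIdempotentElem (Matrix.diagonal d) := by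
  unfold IsIdempotentElem
  rw [Matrix.diagonal_mul_diagonal]
  exact congrArg Matrix.diagonal (funext fun i => (h i).eq)

/-- The class in `K₀(R)` of an idempotent element. -/
def elemClass (x : R) (hx : IsIdempotentElem x) : K0U R :=
  Algebra.GrothendieckAddGroup.of (Quotient.mk _ (IdemMat.single x hx))

theorem matEquiv_diagonal_single {n : ℕ} (i : Fin n) {x : R} (hx : IsIdempotentElem x) :
    MatEquiv (Matrix.diagonal (Pi.single i x)) (Matrix.of fun (_ _ : Fin 1) => x) := by
  refine ⟨Matrix.of fun k (_ : Fin 1) => (Pi.single i x : Fin n → R) k,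
    Matrix.of fun (_ : Fin 1) k => (Pi.single i x : Fin n → R) k, ?_, ?_⟩
  · ext k l
    by_cases hk : k = i
    · by_cases hl : l = i
      · subst hk hl
        simp [Matrix.mul_apply, hx.eq]
      · subst hk
        simp [Matrix.mul_apply, hl, Matrix.diagonal_apply_ne' _ hl]
    · by_cases hkl : k = l
      · subst hkl
        simp [Matrix.mul_apply, hk]
      · simp [Matrix.mul_apply, hk, hkl]
  · ext k l
    simp [Matrix.mul_apply, Pi.single_apply, hx.eq]

theorem idemClass_diagonal_single {n : ℕ} (i : Fin n) {x : R} (hx : IsIdempotentElem x)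
    (h : IsIdempotentElem (Matrix.diagonal (Pi.single i x))) :
    idemClass (Matrix.diagonal (Pi.single i x)) h = elemClass x hx :=
  congrArg Algebra.GrothendieckAddGroup.of (Quotient.sound (matEquiv_diagonal_single i hx))

theorem idemClass_diagonal_three {d : Fin 3 → R} (h : ∀ i, IsIdempotentElem (d i)) :
    idemClass (Matrix.diagonal d) (isIdempotentElem_diagonal h) =
      elemClass (d 0) (h 0) + elemClass (d 1) (h 1) + elemClass (d 2) (h 2) := by
  have hs : ∀ i : Fin 3, IsIdempotentElem (Matrix.diagonal (Pi.single i (d i) : Fin 3 → R)) := by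
    intro i
    refine isIdempotentElem_diagonal fun j => ?_
    by_cases hj : j = i
    · subst hj
      simpa using h j
    · simp [hj, IsIdempotentElem]
  have h01 : IsIdempotentElem (Matrix.diagonal (Pi.single 0 (d 0) + Pi.single 1 (d 1) :
      Fin 3 → R)) := by
    refine isIdempotentElem_diagonal fun j => ?_
    fin_cases j <;> simp [IsIdempotentElem, (h 0).eq, (h 1).eq]
  have h1 := idemClass_add (hs 0) (hs 1) h01 (Matrix.diagonal_add _ _)
    (by rw [Matrix.diagonal_mul_diagonal, ← Matrix.diagonal_zero]
        congr 1; funext j; fin_cases j <;> simp)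
    (by rw [Matrix.diagonal_mul_diagonal, ← Matrix.diagonal_zero]
        congr 1; funext j; fin_cases j <;> simp)
  have h2 := idemClass_add h01 (hs 2) (isIdempotentElem_diagonal h)
    (by rw [Matrix.diagonal_add]
        congr 1; funext j; fin_cases j <;> simp)
    (by rw [Matrix.diagonal_mul_diagonal, ← Matrix.diagonal_zero]
        congr 1; funext j; fin_cases j <;> simp)
    (by rw [Matrix.diagonal_mul_diagonal, ← Matrix.diagonal_zero]
        congr 1; funext j; fin_cases j <;> simp)
  rw [h2, h1, idemClass_diagonal_single 0 (h 0), idemClass_diagonal_single 1 (h 1),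
    idemClass_diagonal_single 2 (h 2)]

end IdempotentClasses

/-! ### Passing from matrices over `N` to matrices over `J⁺`. -/

section Lifting

variable {H : Type*} [NormedAddCommGroup H] [InnerProductSpace ℂ H] [CompleteSpace H]
  {N : VonNeumannAlgebra H} {J : Ideal N} [J.IsTwoSided] {n : ℕ}

/-- The image in `M_n(J⁺)` of a matrix over `J`. -/
def liftMat (X : Matrix (Fin n) (Fin n) (idealAlg J)) :
    Matrix (Fin n) (Fin n) (Unitization ℂ (idealAlg J)) :=
  X.map Unitization.inr

/-- The image in `M_n(N)` of a matrix over `J`. -/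
def coeMat (X : Matrix (Fin n) (Fin n) (idealAlg J)) : Matrix (Fin n) (Fin n) N :=
  X.map Subtype.val

theorem liftMat_mul (X Y : Matrix (Fin n) (Fin n) (idealAlg J)) :
    liftMat (X * Y) = liftMat X * liftMat Y := by
  ext1 i j
  simp only [liftMat, Matrix.map_apply, Matrix.mul_apply]
  simp only [← Unitization.inr_mul]
  exact map_sum (AddMonoidHom.mk' (Unitization.inr : idealAlg J → Unitization ℂ (idealAlg J))
    (Unitization.inr_add ℂ)) _ _

theorem coeMat_mul (X Y : Matrix (Fin n) (Fin n) (idealAlg J)) :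
    coeMat (X * Y) = coeMat X * coeMat Y := by
  ext1 i j
  simp only [coeMat, Matrix.map_apply, Matrix.mul_apply]
  exact map_sum (NonUnitalSubalgebraClass.subtype (idealAlg J)) _ _

theorem liftMat_add (X Y : Matrix (Fin n) (Fin n) (idealAlg J)) :
    liftMat (X + Y) = liftMat X + liftMat Y := by
  ext1 i j
  simp [liftMat]

theorem coeMat_add (X Y : Matrix (Fin n) (Fin n) (idealAlg J)) :
    coeMat (X + Y) = coeMat X + coeMat Y := by
  ext1 i j
  simp [coeMat]

theorem liftMat_neg (X : Matrix (Fin n) (Fin n) (idealAlg J)) : liftMat (-X) = -liftMat X := by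
  ext1 i j
  simp [liftMat]

theorem coeMat_neg (X : Matrix (Fin n) (Fin n) (idealAlg J)) : coeMat (-X) = -coeMat X := by
  ext1 i j
  simp [coeMat]

/-- `J⁺` adjoins a new unit even if `J` already has one, so `J⁺ → N` need not be injective.
Identities are therefore pulled back from `N` to `J` itself and only then sent to `J⁺`. -/
theorem coeMat_injective :
    Function.Injective (coeMat : Matrix (Fin n) (Fin n) (idealAlg J) → _) := by
  intro X Y h
  ext1 i j
  exact Subtype.ext (congrFun (congrFun h i) j)

theorem exists_coeMat_eq {X : Matrix (Fin n) (Fin n) N}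
    (h : (Ideal.Quotient.mk J).mapMatrix X = 0) :
    ∃ Y : Matrix (Fin n) (Fin n) (idealAlg J), coeMat Y = X :=
  ⟨Matrix.of fun i j => ⟨X i j, Ideal.Quotient.eq_zero_iff_mem.1 (congrFun (congrFun h i) j)⟩, rfl⟩

theorem mapMatrix_coeMat (X : Matrix (Fin n) (Fin n) (idealAlg J)) :
    (Ideal.Quotient.mk J).mapMatrix (coeMat X) = 0 := by
  ext1 i j
  exact Ideal.Quotient.eq_zero_iff_mem.2 (X i j).2

theorem isIdempotentElem_liftMat {E : Matrix (Fin n) (Fin n) (idealAlg J)}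
    (h : IsIdempotentElem E) : IsIdempotentElem (liftMat E) := by
  unfold IsIdempotentElem
  rw [← liftMat_mul, h.eq]

theorem isIdempotentElem_of_coeMat {E : Matrix (Fin n) (Fin n) (idealAlg J)}
    (h : IsIdempotentElem (coeMat E)) : IsIdempotentElem E :=
  coeMat_injective ((coeMat_mul E E).trans h.eq)

/-- Idempotents over `J` that are equivalent over `N` have the same class in `K₀(J⁺)`. -/
theorem idemClass_liftMat_congr {E F : Matrix (Fin n) (Fin n) (idealAlg J)}
    (hE : IsIdempotentElem E) (hF : IsIdempotentElem F) {C D : Matrix (Fin n) (Fin n) N}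
    (h1 : C * D = coeMat E) (h2 : D * C = coeMat F) :
    idemClass (liftMat E) (isIdempotentElem_liftMat hE) =
      idemClass (liftMat F) (isIdempotentElem_liftMat hF) := by
  have hE' : coeMat E * coeMat E = coeMat E := by rw [← coeMat_mul, hE.eq]
  have hF' : coeMat F * coeMat F = coeMat F := by rw [← coeMat_mul, hF.eq]
  -- Sandwiching between `E` and `F` moves the implementing matrices into `J` without spoiling the
  -- equivalence.
  obtain ⟨a, ha⟩ := exists_coeMat_eq (J := J) (X := coeMat E * C * coeMat F)
    (by rw [map_mul, mapMatrix_coeMat, mul_zero])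
  obtain ⟨b, hb⟩ := exists_coeMat_eq (J := J) (X := coeMat F * D * coeMat E)
    (by rw [map_mul, mapMatrix_coeMat, mul_zero])
  refine idemClass_congr _ _ ⟨liftMat a, liftMat b, ?_, ?_⟩
  · rw [← liftMat_mul]
    refine congrArg liftMat (coeMat_injective ?_)
    rw [coeMat_mul, ha, hb]
    calc coeMat E * C * coeMat F * (coeMat F * D * coeMat E)
        = coeMat E * C * (coeMat F * coeMat F) * D * coeMat E := by simp only [mul_assoc]
      _ = coeMat E * (C * D) * (C * D) * coeMat E := by
          rw [hF', ← h2]; simp only [mul_assoc]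
      _ = coeMat E := by rw [h1, hE', hE', hE']
  · rw [← liftMat_mul]
    refine congrArg liftMat (coeMat_injective ?_)
    rw [coeMat_mul, ha, hb]
    calc coeMat F * D * coeMat E * (coeMat E * C * coeMat F)
        = coeMat F * D * (coeMat E * coeMat E) * C * coeMat F := by simp only [mul_assoc]
      _ = coeMat F * (D * C) * (D * C) * coeMat F := by
          rw [hE', ← h1]; simp only [mul_assoc]
      _ = coeMat F := by rw [h2, hF', hF', hF']

theorem idemClass_one_sub {R : Type*} [Ring R] {e : Matrix (Fin n) (Fin n) R}
    (he : IsIdempotentElem e) :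
    idemClass (1 : Matrix (Fin n) (Fin n) R) .one = idemClass e he + idemClass (1 - e) he.one_sub :=
  idemClass_add he he.one_sub .one (add_sub_cancel _ _)
    (by rw [mul_sub, mul_one, he.eq, sub_self]) (by rw [sub_mul, one_mul, he.eq, sub_self])

/-- Defects of mutually inverse-up-to-defect matrices congruent to `1` modulo `J` have the same
class. -/
theorem idemClass_liftMat_of_one_sub {E F : Matrix (Fin n) (Fin n) (idealAlg J)}
    (hE : IsIdempotentElem E) (hF : IsIdempotentElem F) {A B : Matrix (Fin n) (Fin n) N}
    (hA : (Ideal.Quotient.mk J).mapMatrix A = 1) (hB : (Ideal.Quotient.mk J).mapMatrix B = 1)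
    (h1 : A * B = 1 - coeMat F) (h2 : B * A = 1 - coeMat E) :
    idemClass (liftMat E) (isIdempotentElem_liftMat hE) =
      idemClass (liftMat F) (isIdempotentElem_liftMat hF) := by
  obtain ⟨X, hX⟩ := exists_coeMat_eq (J := J) (X := A - 1)
    (by rw [map_sub, hA, map_one, sub_self])
  obtain ⟨Y, hY⟩ := exists_coeMat_eq (J := J) (X := B - 1)
    (by rw [map_sub, hB, map_one, sub_self])
  have key : ∀ {X Y G : Matrix (Fin n) (Fin n) (idealAlg J)},
      (coeMat X + 1) * (coeMat Y + 1) = 1 - coeMat G →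
      (1 + liftMat X) * (1 + liftMat Y) = 1 - liftMat G := by
    intro X Y G h
    -- Once the unit is cancelled, the identity involves only matrices over `J` and hence transfers
    -- to `J⁺`.
    have h3 : X + Y + X * Y = -G := by
      refine coeMat_injective ?_
      rw [coeMat_neg, coeMat_add, coeMat_add, coeMat_mul]
      have h4 : coeMat X + coeMat Y + coeMat X * coeMat Y =
        (coeMat X + 1) * (coeMat Y + 1) - 1 := by noncomm_ring
      rw [h4, h]; abel
    have h5 := congrArg liftMat h3
    rw [liftMat_neg, liftMat_add, liftMat_add, liftMat_mul] at h5
    rw [sub_eq_add_neg, ← h5]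
    noncomm_ring
  have hXY := key (X := X) (Y := Y) (G := F) (by rw [hX, hY, sub_add_cancel, sub_add_cancel, h1])
  have hYX := key (X := Y) (Y := X) (G := E) (by rw [hX, hY, sub_add_cancel, sub_add_cancel, h2])
  have hEl := isIdempotentElem_liftMat hE
  have hFl := isIdempotentElem_liftMat hF
  -- The complements of `E` and `F` are equivalent over `J⁺`; both decompose [1], and `K₀` is a
  -- group, so cancellation applies.
  have h3 := idemClass_congr hFl.one_sub hEl.one_sub ⟨_, _, hXY, hYX⟩
  have h4 := (idemClass_one_sub hEl).symm.trans (idemClass_one_sub hFl)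
  rw [h3] at h4
  exact add_right_cancel h4

/-- If `A` is invertible up to the defects `E` and `F`, and its inverse lifts modulo `J` to an
invertible matrix, then the defects have the same class. -/
theorem idemClass_liftMat_of_lift {E F : Matrix (Fin n) (Fin n) (idealAlg J)}
    (hE : IsIdempotentElem E) (hF : IsIdempotentElem F) {A B Z Z' : Matrix (Fin n) (Fin n) N}
    (h1 : A * B = 1 - coeMat F) (h2 : B * A = 1 - coeMat E) (hZ : Z * Z' = 1) (hZ' : Z' * Z = 1)
    (h : (Ideal.Quotient.mk J).mapMatrix Z = (Ideal.Quotient.mk J).mapMatrix B) :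
    idemClass (liftMat E) (isIdempotentElem_liftMat hE) =
      idemClass (liftMat F) (isIdempotentElem_liftMat hF) := by
  obtain ⟨G, hG⟩ := exists_coeMat_eq (J := J) (X := Z * coeMat F * Z')
    (by rw [map_mul, map_mul, mapMatrix_coeMat, mul_zero, zero_mul])
  have hGi : IsIdempotentElem G := by
    refine isIdempotentElem_of_coeMat ?_
    have : Z * coeMat F * Z' * (Z * coeMat F * Z') = Z * (coeMat F * (Z' * Z) * coeMat F) * Z' := by
      simp only [mul_assoc]
    unfold IsIdempotentElem
    rw [hG, this, hZ', mul_one, ← coeMat_mul, hF.eq]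
  have hGF := idemClass_liftMat_congr hGi hF (C := Z * coeMat F) (D := coeMat F * Z')
    (by rw [hG, ← mul_assoc, mul_assoc Z, ← coeMat_mul, hF.eq])
    (by rw [mul_assoc, ← mul_assoc Z', hZ', one_mul, ← coeMat_mul, hF.eq])
  -- ZA ≡ BA ≡ 1 and BZ' ≡ ZZ' = 1 modulo `J`. The corrected pair keeps the defect `E` and replaces
  -- `F` by its conjugate `G`.
  refine (idemClass_liftMat_of_one_sub hE hGi (A := Z * A) (B := B * Z') ?_ ?_ ?_ ?_).trans hGF
  · rw [map_mul, h, ← map_mul, h2, map_sub, mapMatrix_coeMat, map_one, sub_zero]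
  · rw [map_mul, ← h, ← map_mul, hZ, map_one]
  · rw [mul_assoc, ← mul_assoc A, h1, sub_mul, mul_sub, one_mul, hZ, hG, mul_assoc]
  · rw [mul_assoc, ← mul_assoc Z', hZ', one_mul, h2]

end Lifting

/-! ### Rotations and the cyclic 3 × 3 matrices of a triangle. -/

section Dilation

variable {H : Type*} [NormedAddCommGroup H] [InnerProductSpace ℂ H] [CompleteSpace H]
  {N : VonNeumannAlgebra H} {J : Ideal N}

/-- The dilation of a generalized inverse to an invertible `2 × 2` matrix. -/
theorem IsCornerIso.dilation {p q a b e f : N} (h : IsCornerIso J p q a b e f) :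
    (e + 1 - p) * (e + 1 - p) + b * a = 1 ∧ (f + 1 - q) * (f + 1 - q) + a * b = 1 ∧
      (e + 1 - p) * b = b * (f + 1 - q) ∧ (f + 1 - q) * a = a * (e + 1 - p) := by
  have hp : p * p = p := by
    have h1 := h.inv_mul_self
    have h2 := congrArg (fun x => p * x) h1
    simp only [← mul_assoc, h.inv_mul_left, mul_sub, h.left_mul_defect] at h2
    rw [h1] at h2
    exact (sub_left_injective h2).symm
  have hq : q * q = q := by
    have h1 := h.mul_inv_self
    have h2 := congrArg (fun x => q * x) h1
    simp only [← mul_assoc, h.mul_left, mul_sub, h.left_mul_codefect] at h2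
    rw [h1] at h2
    exact (sub_left_injective h2).symm
  refine ⟨?_, ?_, ?_, ?_⟩
  · simp only [add_mul, mul_add, sub_mul, mul_sub, h.defect_idem.eq, h.defect_mul_left,
      h.left_mul_defect, hp, h.inv_mul_self, one_mul, mul_one]
    abel
  · simp only [add_mul, mul_add, sub_mul, mul_sub, h.codefect_idem.eq, h.codefect_mul_left,
      h.left_mul_codefect, hq, h.mul_inv_self, one_mul, mul_one]
    abel
  · simp only [add_mul, mul_add, sub_mul, mul_sub, h.defect_mul_inv, h.inv_mul_left,
      h.inv_mul_defect, h.inv_mul_right, one_mul, mul_one]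
  · simp only [add_mul, mul_add, sub_mul, mul_sub, h.defect_mul, h.mul_left,
      h.mul_defect, h.mul_right, one_mul, mul_one]

/-- The hypotheses are the four relations of `IsCornerIso.dilation`; the 2 × 2 rotation acts on the
first two of three coordinates. -/
theorem rotation_upper_mul {R : Type*} [Ring R] {x y a b : R} (h1 : x * x + b * a = 1)
    (h2 : y * y + a * b = 1) (h3 : x * b = b * y) (h4 : y * a = a * x) :
    !![x, b, 0; -a, y, 0; 0, 0, 1] * !![x, -b, 0; a, y, 0; 0, 0, 1] = 1 := by
  rw [add_comm] at h2
  rw [Matrix.one_fin_three]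
  ext1 i j
  fin_cases i <;> fin_cases j <;> simp [Matrix.mul_apply, Fin.sum_univ_three, h1, h2, h3, h4]

theorem rotation_lower_mul {R : Type*} [Ring R] {x y a b : R} (h1 : x * x + b * a = 1)
    (h2 : y * y + a * b = 1) (h3 : x * b = b * y) (h4 : y * a = a * x) :
    !![1, 0, 0; 0, x, b; 0, -a, y] * !![1, 0, 0; 0, x, -b; 0, a, y] = 1 := by
  rw [add_comm] at h2
  rw [Matrix.one_fin_three]
  ext1 i j
  fin_cases i <;> fin_cases j <;> simp [Matrix.mul_apply, Fin.sum_univ_three, h1, h2, h3, h4]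

variable {p q r a₁ b₁ e₁ f₁ a₂ b₂ e₂ f₂ a₃ b₃ e₃ f₃ : N}

/-- The left factor sends `p → q → r → p` cyclically by a₁, a₂, b₃ and is the identity on the
complements; the right factor runs backwards. The product is diagonal, and each entry falls short of
1 by one defect. -/
theorem triangle_mul_inv (hp : IsIdempotentElem p) (hq : IsIdempotentElem q)
    (hr : IsIdempotentElem r) (h₁ : IsCornerIso J p q a₁ b₁ e₁ f₁)
    (h₂ : IsCornerIso J q r a₂ b₂ e₂ f₂) (h₃ : IsCornerIso J p r a₃ b₃ e₃ f₃) :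
    !![1 - p, 0, b₃; a₁, 1 - q, 0; 0, a₂, 1 - r] * !![1 - p, b₁, 0; 0, 1 - q, b₂; a₃, 0, 1 - r] =
      1 - !![e₃, 0, 0; 0, f₁, 0; 0, 0, f₂] := by
  rw [Matrix.one_fin_three]
  ext1 i j
  fin_cases i <;> fin_cases j <;>
    simp [Matrix.mul_apply, Fin.sum_univ_three, mul_sub, sub_mul, h₁.mul_right,
      h₁.inv_mul_left, h₂.mul_right, h₂.inv_mul_left, h₃.mul_left, h₃.inv_mul_right,
      h₁.mul_inv_self, h₂.mul_inv_self, h₃.inv_mul_self, hp.eq, hq.eq, hr.eq]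

theorem triangle_inv_mul (hp : IsIdempotentElem p) (hq : IsIdempotentElem q)
    (hr : IsIdempotentElem r) (h₁ : IsCornerIso J p q a₁ b₁ e₁ f₁)
    (h₂ : IsCornerIso J q r a₂ b₂ e₂ f₂) (h₃ : IsCornerIso J p r a₃ b₃ e₃ f₃) :
    !![1 - p, b₁, 0; 0, 1 - q, b₂; a₃, 0, 1 - r] * !![1 - p, 0, b₃; a₁, 1 - q, 0; 0, a₂, 1 - r] =
      1 - !![e₁, 0, 0; 0, e₂, 0; 0, 0, f₃] := by
  rw [Matrix.one_fin_three]
  ext1 i j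
  fin_cases i <;> fin_cases j <;>
    simp [Matrix.mul_apply, Fin.sum_univ_three, mul_sub, sub_mul, h₁.mul_left,
      h₁.inv_mul_right, h₂.mul_left, h₂.inv_mul_right, h₃.mul_right, h₃.inv_mul_left,
      h₁.inv_mul_self, h₂.inv_mul_self, h₃.mul_inv_self, hp.eq, hq.eq, hr.eq]

end Dilation

/-! ### Additivity for a triangle that commutes modulo `J`. -/

section Cocycle

variable {H : Type*} [NormedAddCommGroup H] [InnerProductSpace ℂ H] [CompleteSpace H]
  {N : VonNeumannAlgebra H} {J : Ideal N} [J.IsTwoSided]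

/-- The element `[x] ∈ K₀(J)` when `x ∈ J` is idempotent, and `0` otherwise. -/
def idealClass (J : Ideal N) [J.IsTwoSided] (x : N) : K0 (idealAlg J) :=
  open Classical in
  if h : IsIdempotentElem x ∧ x ∈ J then projClass J x h.1 h.2 else 0

theorem idealClass_eq {x : N} (h : IsIdempotentElem x) (hJ : x ∈ J) :
    idealClass J x = projClass J x h hJ :=
  dif_pos ⟨h, hJ⟩

theorem coe_idealClass {x : idealAlg J} (h : IsIdempotentElem x)
    (h' : IsIdempotentElem (Unitization.inr x : Unitization ℂ (idealAlg J))) :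
    (idealClass J x.1 : K0U (Unitization ℂ (idealAlg J))) = elemClass (Unitization.inr x) h' := by
  rw [idealClass_eq (congrArg Subtype.val h) x.2]
  rfl

theorem idemClass_liftMat_diagonal {d : Fin 3 → idealAlg J} (h : ∀ i, IsIdempotentElem (d i)) :
    idemClass (liftMat (Matrix.diagonal d))
        (isIdempotentElem_liftMat (isIdempotentElem_diagonal h)) =
      ((idealClass J (d 0).1 + idealClass J (d 1).1 + idealClass J (d 2).1 :
        K0 (idealAlg J)) : K0U (Unitization ℂ (idealAlg J))) := by
  have h' : ∀ i, IsIdempotentElem (Unitization.inr (d i) : Unitization ℂ (idealAlg J)) := by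
    intro i
    unfold IsIdempotentElem
    rw [← Unitization.inr_mul, (h i).eq]
  have e : liftMat (Matrix.diagonal d) = Matrix.diagonal fun i =>
      (Unitization.inr (d i) : Unitization ℂ (idealAlg J)) :=
    Matrix.diagonal_map (Unitization.inr_zero ℂ)
  have h2 := idemClass_diagonal_three h'
  rw [← coe_idealClass (h 0), ← coe_idealClass (h 1), ← coe_idealClass (h 2)] at h2
  refine Eq.trans ?_ h2
  congr 1

section Triangle

variable {p q r a₁ b₁ e₁ f₁ a₂ b₂ e₂ f₂ a₃ b₃ e₃ f₃ : N}

/-- Modulo `J` the defects vanish and (1 - q)a₁ = 0 = a₂(1 - q). The only corner that remains to be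
matched is a₂a₁ against a₃, which is where commutativity of the triangle enters. -/
theorem rotations_congr_triangle_inv (hq : IsIdempotentElem q)
    (h₁ : IsCornerIso J p q a₁ b₁ e₁ f₁) (h₂ : IsCornerIso J q r a₂ b₂ e₂ f₂)
    (h : a₂ * a₁ - a₃ ∈ J) :
    (Ideal.Quotient.mk J).mapMatrix (!![1, 0, 0; 0, e₂ + 1 - q, b₂; 0, -a₂, f₂ + 1 - r] *
        !![e₁ + 1 - p, b₁, 0; -a₁, f₁ + 1 - q, 0; 0, 0, 1]) =
      (Ideal.Quotient.mk J).mapMatrix !![1 - p, b₁, 0; 0, 1 - q, b₂; a₃, 0, 1 - r] := by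
  have z : ∀ {x : N}, x ∈ J → Ideal.Quotient.mk J x = 0 := Ideal.Quotient.eq_zero_iff_mem.2
  have t := Ideal.Quotient.eq.2 h
  have u := congrArg (Ideal.Quotient.mk J) h₁.mul_left
  have v := congrArg (Ideal.Quotient.mk J) h₂.mul_right
  have w := congrArg (Ideal.Quotient.mk J) hq.eq
  rw [map_mul] at t u v w
  have ze₁ := z h₁.defect_mem
  have zf₁ := z h₁.codefect_mem
  have ze₂ := z h₂.defect_mem
  have zf₂ := z h₂.codefect_mem
  ext1 i j
  simp only [RingHom.mapMatrix_apply, Matrix.map_apply, Matrix.mul_apply, Fin.sum_univ_three]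
  fin_cases i <;> fin_cases j <;>
    simp [mul_sub, sub_mul, ze₁, zf₁, ze₂, zf₂, t, u, v, w]

end Triangle

/-- Additivity of the index along a triangle that commutes modulo `J`. -/
theorem idealClass_cocycle {p q r a₁ b₁ e₁ f₁ a₂ b₂ e₂ f₂ a₃ b₃ e₃ f₃ : N}
    (hp : IsIdempotentElem p) (hq : IsIdempotentElem q) (hr : IsIdempotentElem r)
    (h₁ : IsCornerIso J p q a₁ b₁ e₁ f₁) (h₂ : IsCornerIso J q r a₂ b₂ e₂ f₂)
    (h₃ : IsCornerIso J p r a₃ b₃ e₃ f₃) (h : a₂ * a₁ - a₃ ∈ J) :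
    idealClass J e₁ + idealClass J e₂ + idealClass J f₃ =
      idealClass J e₃ + idealClass J f₁ + idealClass J f₂ := by
  have hi : ∀ {x : N} (hx : x ∈ J), IsIdempotentElem x →
      IsIdempotentElem (⟨x, hx⟩ : idealAlg J) := fun hx h => Subtype.ext h
  let dE : Fin 3 → idealAlg J :=
    ![⟨e₁, h₁.defect_mem⟩, ⟨e₂, h₂.defect_mem⟩, ⟨f₃, h₃.codefect_mem⟩]
  let dF : Fin 3 → idealAlg J :=
    ![⟨e₃, h₃.defect_mem⟩, ⟨f₁, h₁.codefect_mem⟩, ⟨f₂, h₂.codefect_mem⟩]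
  have hdE : ∀ i, IsIdempotentElem (dE i) := by
    intro i
    fin_cases i
    exacts [hi _ h₁.defect_idem, hi _ h₂.defect_idem, hi _ h₃.codefect_idem]
  have hdF : ∀ i, IsIdempotentElem (dF i) := by
    intro i
    fin_cases i
    exacts [hi _ h₃.defect_idem, hi _ h₁.codefect_idem, hi _ h₂.codefect_idem]
  have cE : coeMat (Matrix.diagonal dE) = !![e₁, 0, 0; 0, e₂, 0; 0, 0, f₃] := by
    ext1 i j
    fin_cases i <;> fin_cases j <;> simp [coeMat, dE]
  have cF : coeMat (Matrix.diagonal dF) = !![e₃, 0, 0; 0, f₁, 0; 0, 0, f₂] := by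
    ext1 i j
    fin_cases i <;> fin_cases j <;> simp [coeMat, dF]
  have key := idemClass_liftMat_of_lift (isIdempotentElem_diagonal hdE)
    (isIdempotentElem_diagonal hdF)
    (A := !![1 - p, 0, b₃; a₁, 1 - q, 0; 0, a₂, 1 - r])
    (B := !![1 - p, b₁, 0; 0, 1 - q, b₂; a₃, 0, 1 - r])
    (Z := !![1, 0, 0; 0, e₂ + 1 - q, b₂; 0, -a₂, f₂ + 1 - r] *
      !![e₁ + 1 - p, b₁, 0; -a₁, f₁ + 1 - q, 0; 0, 0, 1])
    (Z' := !![e₁ + 1 - p, -b₁, 0; a₁, f₁ + 1 - q, 0; 0, 0, 1] *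
      !![1, 0, 0; 0, e₂ + 1 - q, -b₂; 0, a₂, f₂ + 1 - r]) ?_ ?_ ?_ ?_ ?_
  · rw [idemClass_liftMat_diagonal hdE, idemClass_liftMat_diagonal hdF] at key
    exact Subtype.ext key
  · rw [cF, triangle_mul_inv hp hq hr h₁ h₂ h₃]
  · rw [cE, triangle_inv_mul hp hq hr h₁ h₂ h₃]
  · obtain ⟨k1, k2, k3, k4⟩ := h₁.dilation
    obtain ⟨l1, l2, l3, l4⟩ := h₂.dilation
    rw [mul_assoc, ← mul_assoc (!![e₁ + 1 - p, b₁, 0; -a₁, f₁ + 1 - q, 0; 0, 0, 1]),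
      rotation_upper_mul k1 k2 k3 k4, one_mul, rotation_lower_mul l1 l2 l3 l4]
  · obtain ⟨k1, k2, k3, k4⟩ := h₁.dilation
    obtain ⟨l1, l2, l3, l4⟩ := h₂.dilation
    have k := rotation_upper_mul (x := e₁ + 1 - p) (y := f₁ + 1 - q) (a := -a₁) (b := -b₁)
      (by rwa [neg_mul_neg b₁]) (by rwa [neg_mul_neg a₁]) (by rw [mul_neg, neg_mul, k3])
      (by rw [mul_neg, neg_mul, k4])
    have l := rotation_lower_mul (x := e₂ + 1 - q) (y := f₂ + 1 - r) (a := -a₂) (b := -b₂)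
      (by rwa [neg_mul_neg b₂]) (by rwa [neg_mul_neg a₂]) (by rw [mul_neg, neg_mul, l3])
      (by rw [mul_neg, neg_mul, l4])
    rw [neg_neg, neg_neg] at k l
    rw [mul_assoc, ← mul_assoc (!![1, 0, 0; 0, e₂ + 1 - q, -b₂; 0, a₂, f₂ + 1 - r]), l, one_mul, k]
  · exact rotations_congr_triangle_inv hq h₁ h₂ h

end Cocycle

/-! ### Essential codimension, its additivity and its relation to the index. -/

section EssentialCodimension

variable {H : Type*} [NormedAddCommGroup H] [InnerProductSpace ℂ H] [CompleteSpace H]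
  {N : VonNeumannAlgebra H} {J : Ideal N} [J.IsTwoSided] {p q r : N}

theorem qnorm_sub (p q : N) :
    qnorm J (p - q) = ‖Ideal.Quotient.mk J p - Ideal.Quotient.mk J q‖ := by
  unfold qnorm
  rw [map_sub]

/-- The elements `c`, `d` need not lie in `J`: equivalence over `N` suffices. -/
theorem idealClass_congr {x y c d : N} (hx : IsIdempotentElem x) (hxJ : x ∈ J)
    (hy : IsIdempotentElem y) (hyJ : y ∈ J) (h1 : c * d = x) (h2 : d * c = y) :
    idealClass J x = idealClass J y := by
  have hc : ∀ {z : N} (hz : z ∈ J), IsIdempotentElem z →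
      IsIdempotentElem (Matrix.of fun (_ _ : Fin 1) => (⟨z, hz⟩ : idealAlg J)) := by
    intro z hz h
    refine isIdempotentElem_of_coeMat ?_
    ext1 i j
    simp [coeMat, Matrix.mul_apply, h.eq]
  have key := idemClass_liftMat_congr (hc hxJ hx) (hc hyJ hy)
    (C := Matrix.of fun _ _ => c) (D := Matrix.of fun _ _ => d)
    (by ext1 i j; simp [coeMat, Matrix.mul_apply, h1])
    (by ext1 i j; simp [coeMat, Matrix.mul_apply, h2])
  rw [idealClass_eq hx hxJ, idealClass_eq hy hyJ]
  exact Subtype.ext key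

/-- The essential codimension `[(1 - q) ∩ p] - [(1 - p) ∩ q]` of a pair of projections. -/
def essCodim (J : Ideal N) [J.IsTwoSided] (p q : N) : K0 (idealAlg J) :=
  idealClass J (infProj (1 - q) p) - idealClass J (infProj (1 - p) q)

theorem essCodim_self (p : N) : essCodim J p p = 0 := sub_self _

theorem essCodim_swap (p q : N) : essCodim J q p = -essCodim J p q := (neg_sub _ _).symm

theorem essCodim_add (hJ : IsClosed (J : Set N)) (hp : IsStarProjection p)
    (hq : IsStarProjection q) (hr : IsStarProjection r) (hpq : qnorm J (p - q) < 1 / 2)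
    (hqr : qnorm J (q - r) < 1 / 2) (hpr : qnorm J (p - r) < 1 / 2) :
    essCodim J p q + essCodim J q r = essCodim J p r := by
  have hhalf : (1 / 2 : ℝ) < 1 := by norm_num
  have h₁ := isCornerIso_genericIso hJ hp hq (hpq.trans hhalf)
  have h₂ := isCornerIso_genericIso hJ hq hr (hqr.trans hhalf)
  have h₃ := isCornerIso_genericIso hJ hp hr (hpr.trans hhalf)
  have hpi := hp.isIdempotentElem
  obtain ⟨g, g', hg, -, hgp, hpg', hg'p, hgg', hg'g⟩ := exists_corner_inverse (J := J)
    (x := star (genericIso p r) * genericIso q r * genericIso p q) hpi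
    (by rw [← mul_assoc, ← mul_assoc, h₃.inv_mul_left]) (by rw [mul_assoc, h₁.mul_right])
    (qnorm_sub_triangle_lt_one hJ hp hq hr hpq hqr hpr) (norm_le_one_of_isStarProjection hp)
  -- Correcting the direct map `p → r` by the invertible lift `g` of the holonomy makes the triangle
  -- commute modulo `J`.
  have h₃' := h₃.comp_right hgp hpg' hg'p hgg' hg'g
  have hcong : genericIso q r * genericIso p q - genericIso p r * g ∈ J := by
    have e : genericIso q r * genericIso p q - genericIso p r * g =
        infProj (1 - p) r * (genericIso q r * genericIso p q) -
          genericIso p r * (g - star (genericIso p r) * genericIso q r * genericIso p q) := by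
      have e2 : genericIso p r * (star (genericIso p r) * genericIso q r * genericIso p q) =
          genericIso q r * genericIso p q -
            infProj (1 - p) r * (genericIso q r * genericIso p q) := by
        rw [mul_assoc, ← mul_assoc, h₃.mul_inv_self, sub_mul, ← mul_assoc r, h₂.mul_left]
      rw [mul_sub, e2]; abel
    rw [e]
    exact J.sub_mem (J.mul_mem_right _ h₃.codefect_mem) (J.mul_mem_left _ hg)
  have key := idealClass_cocycle hpi hq.isIdempotentElem hr.isIdempotentElem h₁ h₂ h₃' hcong
  -- The correction only conjugated the defect, so its class is unchanged.
  have hconj : idealClass J (g' * infProj (1 - r) p * g) = idealClass J (infProj (1 - r) p) := by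
    refine idealClass_congr h₃'.defect_idem h₃'.defect_mem h₃.defect_idem h₃.defect_mem
      (c := g') (d := infProj (1 - r) p * g) (mul_assoc _ _ _).symm ?_
    rw [mul_assoc, hgg', h₃.defect_mul_left]
  rw [hconj] at key
  unfold essCodim
  rw [← sub_eq_zero] at key ⊢
  rw [← key]
  abel

theorem mem_range_kerProj_iff {S : N} {x : H} :
    x ∈ (kerProj S : H →L[ℂ] H).range ↔ (S : H →L[ℂ] H) x = 0 := by
  refine ⟨mem_range_kerProj S x, fun h => ?_⟩
  have hr : (kerProj S : H →L[ℂ] H).range = (S : H →L[ℂ] H).ker.topologicalClosure :=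
    Submodule.range_starProjection _
  rw [hr]
  exact Submodule.le_topologicalClosure _ h

theorem infProj_kerProj_mul (hp : IsIdempotentElem p) (hq : IsIdempotentElem q) :
    infProj (kerProj (q * p)) p = infProj (1 - q) p := by
  have h : (kerProj (q * p) : H →L[ℂ] H).range ⊓ (p : H →L[ℂ] H).range =
      ((1 - q : N) : H →L[ℂ] H).range ⊓ (p : H →L[ℂ] H).range := by
    ext x
    simp only [Submodule.mem_inf]
    refine and_congr_left fun hx => ?_
    rw [mem_range_kerProj_iff]
    have hpx := apply_of_mem_range p hp x hx
    have h1 : ((q * p : N) : H →L[ℂ] H) x = (q : H →L[ℂ] H) x := by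
      change (q : H →L[ℂ] H) ((p : H →L[ℂ] H) x) = _
      rw [hpx]
    rw [h1]
    constructor
    · intro h0
      refine ⟨x, ?_⟩
      change x - (q : H →L[ℂ] H) x = x
      rw [h0, sub_zero]
    · intro h0
      have h2 : x - (q : H →L[ℂ] H) x = x := apply_of_mem_range (1 - q) hq.one_sub x h0
      exact sub_eq_self.1 h2
  refine Subtype.ext ?_
  change projOnto _ = projOnto _
  rw [h]

theorem relIndex_eq_essCodim (hJ : IsClosed (J : Set N)) (hp : IsStarProjection p)
    (hq : IsStarProjection q) (hpq : qnorm J (p - q) < 1) (h : IsRelFredholm J q p (q * p)) :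
    relIndex hq hp h = essCodim J p q := by
  obtain ⟨h1, h2⟩ := infProj_one_sub_mem hJ hp hq hpq
  have e1 := infProj_kerProj_mul hp.isIdempotentElem hq.isIdempotentElem
  have e2 : infProj (kerProj (star (q * p))) q = infProj (1 - p) q := by
    rw [star_mul, hp.isSelfAdjoint.star_eq, hq.isSelfAdjoint.star_eq]
    exact infProj_kerProj_mul hq.isIdempotentElem hp.isIdempotentElem
  unfold relIndex essCodim
  rw [← e1, ← e2, idealClass_eq (isIdempotentElem_infProj _ _) (h.ker_mem hp),
    idealClass_eq (isIdempotentElem_infProj _ _) (h.coker_mem hq)]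

/-- `p - q` acts as the identity on this intersection, which a norm below 1 permits only if the
intersection is zero. -/
theorem infProj_one_sub_eq_zero (hp : IsIdempotentElem p) (hq : IsIdempotentElem q)
    (h : ‖p - q‖ < 1) : infProj (1 - q) p = 0 := by
  have h1 : (p - q) * infProj (1 - q) p = infProj (1 - q) p := by
    rw [sub_mul, mul_infProj_one_sub p hq, right_mul_infProj _ hp, sub_zero]
  have h2 := norm_mul_le (p - q) (infProj (1 - q) p)
  rw [h1] at h2
  have h3 := norm_nonneg (infProj (1 - q) p)
  exact norm_eq_zero.1 (by nlinarith)

theorem essCodim_eq_zero (hp : IsIdempotentElem p) (hq : IsIdempotentElem q)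
    (h : ‖p - q‖ < 1) : essCodim J p q = 0 := by
  unfold essCodim
  rw [infProj_one_sub_eq_zero hp hq h, infProj_one_sub_eq_zero hq hp ((norm_sub_rev _ _).trans_lt h),
    sub_self]

/-- Comparison of the total essential codimensions of two neighbouring chains of projections. -/
theorem sum_essCodim_ladder (hJ : IsClosed (J : Set N)) {n : ℕ} {u v : Fin (n + 1) → N}
    (hu : ∀ i, IsStarProjection (u i)) (hv : ∀ i, IsStarProjection (v i))
    (huv : ∀ i, qnorm J (u i - v i) < 1 / 2)
    (huu : ∀ i : Fin n, qnorm J (u i.castSucc - u i.succ) < 1 / 2)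
    (hvv : ∀ i : Fin n, qnorm J (v i.castSucc - v i.succ) < 1 / 2)
    (hd : ∀ i : Fin n, qnorm J (u i.castSucc - v i.succ) < 1 / 2) :
    ∑ i : Fin n, essCodim J (u i.castSucc) (u i.succ) + essCodim J (u (Fin.last n)) (v (Fin.last n)) =
      essCodim J (u 0) (v 0) + ∑ i : Fin n, essCodim J (v i.castSucc) (v i.succ) := by
  -- The diagonal from `u i` to `v (i + 1)` cuts each square into two triangles; the rungs then
  -- telescope.
  have h : ∀ i : Fin n, essCodim J (u i.castSucc) (u i.succ) - essCodim J (v i.castSucc) (v i.succ) =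
      essCodim J (u i.castSucc) (v i.castSucc) - essCodim J (u i.succ) (v i.succ) := by
    intro i
    have h1 := essCodim_add hJ (hu i.castSucc) (hu i.succ) (hv i.succ) (huu i) (huv _) (hd i)
    have h2 := essCodim_add hJ (hu i.castSucc) (hv i.castSucc) (hv i.succ) (huv _) (hvv i) (hd i)
    rw [sub_eq_sub_iff_add_eq_add, h1, h2]
  have htel : ∀ {n : ℕ} (w : Fin (n + 1) → K0 (idealAlg J)),
      ∑ i : Fin n, (w i.castSucc - w i.succ) = w 0 - w (Fin.last n) := by
    intro n w
    induction n with
    | zero => simp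
    | succ n ih =>
      rw [Fin.sum_univ_castSucc]
      have := ih fun i => w i.castSucc
      simp only [Fin.succ_castSucc, Fin.castSucc_zero, Fin.succ_last] at this ⊢
      rw [this]; abel
  have hs := Finset.sum_congr (rfl : (Finset.univ : Finset (Fin n)) = _) fun i _ => h i
  rw [Finset.sum_sub_distrib, htel fun i => essCodim J (u i) (v i), sub_eq_sub_iff_add_eq_add] at hs
  exact hs

end EssentialCodimension

/-! ### Sums of locally additive functions along subdivisions. -/

section Subdivision

variable {I G : Type*} [AddCommGroup G] {E : I → I → G}

theorem sum_chain {S : Set I} (h0 : ∀ x, E x x = 0)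
    (hE : ∀ x ∈ S, ∀ y ∈ S, ∀ z ∈ S, E x y + E y z = E x z) {m : ℕ} (u : Fin (m + 1) → I)
    (hu : ∀ j, u j ∈ S) :
    ∑ j : Fin m, E (u j.castSucc) (u j.succ) = E (u 0) (u (Fin.last m)) := by
  induction m with
  | zero => simp [h0]
  | succ m ih =>
    rw [Fin.sum_univ_castSucc]
    have := ih (fun i => u i.castSucc) fun i => hu _
    simp only [Fin.succ_castSucc, Fin.castSucc_zero, Fin.succ_last] at this ⊢
    rw [this, hE _ (hu _) _ (hu _) _ (hu _)]

variable [LinearOrder I]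

/-- Clamping [c, d] into [a, b] or the other way round yields the endpoints of the intersection; for
disjoint intervals both sides are of the form E x x. This takes the place of a common refinement:
the double sum over pairs of intervals is symmetric. -/
theorem clamp_symm (h0 : ∀ x, E x x = 0) {a b c d : I} (hab : a ≤ b) (hcd : c ≤ d) :
    E (max a (min c b)) (max a (min d b)) = E (max c (min a d)) (max c (min b d)) := by
  rcases lt_or_ge b c with h | h
  · rw [min_eq_right h.le, min_eq_right (h.le.trans hcd), h0, min_eq_left (hab.trans (h.le.trans hcd)),
      min_eq_left (h.le.trans hcd), max_eq_left h.le, max_eq_left (hab.trans h.le), h0]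
  rcases lt_or_ge d a with h' | h'
  · rw [min_eq_right h'.le, min_eq_right (h'.le.trans hab), h0, min_eq_left (hcd.trans (h'.le.trans hab)),
      min_eq_left (h'.le.trans hab), max_eq_left h'.le, max_eq_left (hcd.trans h'.le), h0]
  rw [min_eq_left h, min_eq_left h', max_comm c a, min_comm d b, max_eq_right (le_min hab h'),
    max_eq_right (le_min h hcd)]

/-- The sum of a locally additive function along a subdivision does not depend on the
subdivision. -/
theorem sum_subdivision_eq (h0 : ∀ x, E x x = 0) {m n : ℕ} {s : Fin (m + 1) → I}
    {t : Fin (n + 1) → I} (hs : Monotone s) (ht : Monotone t) (hst0 : s 0 = t 0)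
    (hst1 : s (Fin.last m) = t (Fin.last n))
    (hsE : ∀ i : Fin m, ∀ x ∈ Set.Icc (s i.castSucc) (s i.succ),
      ∀ y ∈ Set.Icc (s i.castSucc) (s i.succ), ∀ z ∈ Set.Icc (s i.castSucc) (s i.succ),
        E x y + E y z = E x z)
    (htE : ∀ i : Fin n, ∀ x ∈ Set.Icc (t i.castSucc) (t i.succ),
      ∀ y ∈ Set.Icc (t i.castSucc) (t i.succ), ∀ z ∈ Set.Icc (t i.castSucc) (t i.succ),
        E x y + E y z = E x z) :
    ∑ i : Fin m, E (s i.castSucc) (s i.succ) = ∑ j : Fin n, E (t j.castSucc) (t j.succ) := by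
  have key : ∀ {m n : ℕ} {s : Fin (m + 1) → I} {t : Fin (n + 1) → I}, Monotone s → Monotone t →
      s 0 = t 0 → s (Fin.last m) = t (Fin.last n) →
      (∀ i : Fin m, ∀ x ∈ Set.Icc (s i.castSucc) (s i.succ),
        ∀ y ∈ Set.Icc (s i.castSucc) (s i.succ), ∀ z ∈ Set.Icc (s i.castSucc) (s i.succ),
          E x y + E y z = E x z) →
      ∀ i : Fin m, E (s i.castSucc) (s i.succ) =
        ∑ j : Fin n, E (max (s i.castSucc) (min (t j.castSucc) (s i.succ)))
          (max (s i.castSucc) (min (t j.succ) (s i.succ))) := by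
    intro m n s t hs ht h1 h2 hE i
    have hle : s i.castSucc ≤ s i.succ := hs i.castSucc_le_succ
    rw [sum_chain h0 (hE i) (fun j => max (s i.castSucc) (min (t j) (s i.succ))) fun j =>
      ⟨le_max_left _ _, max_le hle (min_le_right _ _)⟩, ← h1, ← h2,
      min_eq_left (hs (Fin.zero_le _)), max_eq_left (hs (Fin.zero_le _)),
      min_eq_right (hs (Fin.le_last _)), max_eq_right hle]
  rw [Finset.sum_congr rfl fun i _ => key hs ht hst0 hst1 hsE i,
    Finset.sum_congr rfl fun j _ => key ht hs hst0.symm hst1.symm htE j, Finset.sum_comm]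
  refine Finset.sum_congr rfl fun j _ => Finset.sum_congr rfl fun i _ => ?_
  exact clamp_symm h0 (hs i.castSucc_le_succ) (ht j.castSucc_le_succ)

end Subdivision

/-! ### Equidistant points of the unit interval. -/

section Grid

/-- The point `i / n` of the unit interval. -/
def gridPoint {n : ℕ} (i : Fin (n + 1)) : unitInterval :=
  ⟨(i : ℝ) / n, div_nonneg (Nat.cast_nonneg _) (Nat.cast_nonneg _),
    div_le_one_of_le₀ (Nat.cast_le.2 (Nat.lt_succ_iff.1 i.2)) (Nat.cast_nonneg _)⟩

theorem gridPoint_strictMono {n : ℕ} (hn : 0 < n) : StrictMono (gridPoint (n := n)) := by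
  intro i j hij
  have hn' : (0 : ℝ) < n := Nat.cast_pos.2 hn
  change (i : ℝ) / n < (j : ℝ) / n
  have : ((i : ℕ) : ℝ) < ((j : ℕ) : ℝ) := Nat.cast_lt.2 hij
  gcongr

theorem gridPoint_zero {n : ℕ} : gridPoint (0 : Fin (n + 1)) = 0 :=
  Subtype.ext (by simp [gridPoint])

theorem gridPoint_last {n : ℕ} (hn : 0 < n) : gridPoint (Fin.last n) = 1 := by
  have hn' : (n : ℝ) ≠ 0 := Nat.cast_ne_zero.2 hn.ne'
  exact Subtype.ext (by simp [gridPoint, hn'])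

theorem gridPoint_succ {n : ℕ} (i : Fin n) :
    (gridPoint i.succ : ℝ) = (gridPoint i.castSucc : ℝ) + 1 / n := by
  simp [gridPoint, add_div]

theorem dist_le_of_mem_Icc_gridPoint {n : ℕ} {i : Fin n} {r s : unitInterval}
    (hr : r ∈ Set.Icc (gridPoint i.castSucc) (gridPoint i.succ))
    (hs : s ∈ Set.Icc (gridPoint i.castSucc) (gridPoint i.succ)) : dist r s ≤ 1 / n := by
  have h := gridPoint_succ i
  have h1 : (gridPoint i.castSucc : ℝ) ≤ r := hr.1
  have h2 : (r : ℝ) ≤ gridPoint i.succ := hr.2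
  have h3 : (gridPoint i.castSucc : ℝ) ≤ s := hs.1
  have h4 : (s : ℝ) ≤ gridPoint i.succ := hs.2
  rw [Subtype.dist_eq, Real.dist_eq, abs_le]
  constructor <;> linarith

theorem gridPoint_mem {n : ℕ} (i : Fin n) :
    gridPoint i.castSucc ∈ Set.Icc (gridPoint i.castSucc) (gridPoint i.succ) ∧
      gridPoint i.succ ∈ Set.Icc (gridPoint i.castSucc) (gridPoint i.succ) := by
  have h : gridPoint i.castSucc ≤ gridPoint i.succ := by
    change (gridPoint i.castSucc : ℝ) ≤ gridPoint i.succ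
    rw [gridPoint_succ]
    have : (0 : ℝ) ≤ 1 / n := by positivity
    linarith
  exact ⟨Set.left_mem_Icc.2 h, Set.right_mem_Icc.2 h⟩

end Grid

/-! ### Spectral flow: existence, independence and invariance. -/

section SpectralFlow

variable {H : Type*} [NormedAddCommGroup H] [InnerProductSpace ℂ H] [CompleteSpace H]
  {N : VonNeumannAlgebra H} {J : Ideal N} [J.IsTwoSided]

/-- Uniform continuity on a compact space; it serves both the interval and the square. -/
theorem exists_mesh (hJ : IsClosed (J : Set N)) {X : Type*} [PseudoMetricSpace X] [CompactSpace X]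
    (F : C(X, FredholmSA J)) :
    ∃ n : ℕ, 0 < n ∧ ∀ x y : X, dist x y ≤ 1 / n →
      qnorm J (chi (F x).1 - chi (F y).1) < 1 / 2 := by
  have hc : Continuous fun x => Ideal.Quotient.mk J (chi (F x).1) :=
    (continuous_mk_chi hJ).comp F.continuous
  have hu := CompactSpace.uniformContinuous_of_continuous hc
  obtain ⟨δ, hδ, h⟩ := Metric.uniformContinuous_iff.1 hu (1 / 2) (by norm_num)
  obtain ⟨n, hn⟩ := exists_nat_one_div_lt hδ
  refine ⟨n + 1, n.succ_pos, fun x y hxy => ?_⟩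
  have hd := h (hxy.trans_lt (by push_cast; exact hn))
  rwa [dist_eq_norm, ← qnorm_sub] at hd

/-- The partition into `n` intervals of equal length. -/
def gridPartition (B : C(unitInterval, FredholmSA J)) {n : ℕ} (hn : 0 < n)
    (h : ∀ r s : unitInterval, dist r s ≤ 1 / n →
      qnorm J (chi (B r).1 - chi (B s).1) < 1 / 2) : FlowPartition J B where
  n := n
  t := gridPoint
  strictMono := gridPoint_strictMono hn
  first := gridPoint_zero
  last := gridPoint_last hn
  small i r hr s hs := by
    rw [← qnorm_sub]
    exact h r s (dist_le_of_mem_Icc_gridPoint hr hs)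

theorem nonempty_flowPartition (hJ : IsClosed (J : Set N)) (B : C(unitInterval, FredholmSA J)) :
    Nonempty (FlowPartition J B) := by
  obtain ⟨n, hn, h⟩ := exists_mesh hJ B
  exact ⟨gridPartition B hn h⟩

variable {B C : C(unitInterval, FredholmSA J)}

theorem FlowPartition.flow_eq (hJ : IsClosed (J : Set N)) (P : FlowPartition J B) :
    P.flow hJ = ∑ i : Fin P.n, essCodim J (P.proj i.castSucc) (P.proj i.succ) := by
  refine Finset.sum_congr rfl fun i _ => ?_
  have h := P.small_proj i
  rw [← qnorm_sub] at h
  have hm := infProj_one_sub_mem hJ (p := P.proj i.castSucc) (q := P.proj i.succ)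
    (isStarProjection_chi _) (isStarProjection_chi _) h
  unfold essCodim
  rw [idealClass_eq (isIdempotentElem_infProj _ _) hm.1,
    idealClass_eq (isIdempotentElem_infProj _ _) hm.2]

/-- Admissibility bounds all pairs of points in an interval, not just its endpoints, so
`essCodim_add` applies to any three points of it. -/
theorem FlowPartition.flow_eq_flow (hJ : IsClosed (J : Set N)) (P Q : FlowPartition J B) :
    P.flow hJ = Q.flow hJ := by
  rw [P.flow_eq, Q.flow_eq]
  have hE : ∀ (P : FlowPartition J B) (i : Fin P.n),
      ∀ x ∈ Set.Icc (P.t i.castSucc) (P.t i.succ), ∀ y ∈ Set.Icc (P.t i.castSucc) (P.t i.succ),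
        ∀ z ∈ Set.Icc (P.t i.castSucc) (P.t i.succ),
          essCodim J (chi (B x).1) (chi (B y).1) + essCodim J (chi (B y).1) (chi (B z).1) =
            essCodim J (chi (B x).1) (chi (B z).1) := by
    intro P i x hx y hy z hz
    refine essCodim_add hJ (isStarProjection_chi _) (isStarProjection_chi _)
      (isStarProjection_chi _) ?_ ?_ ?_ <;> rw [qnorm_sub]
    exacts [P.small i x hx y hy, P.small i y hy z hz, P.small i x hx z hz]
  exact sum_subdivision_eq (E := fun x y => essCodim J (chi (B x).1) (chi (B y).1))
    (fun _ => essCodim_self _) P.strictMono.monotone Q.strictMono.monotone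
    (P.first.trans Q.first.symm) (P.last.trans Q.last.symm) (hE P) (hE Q)

theorem FlowPartition.flow_eq_spectralFlow (hJ : IsClosed (J : Set N)) (P : FlowPartition J B) :
    P.flow hJ = spectralFlow hJ B := by
  unfold spectralFlow
  rw [dif_pos ⟨P⟩]
  exact P.flow_eq_flow hJ _

theorem spectralFlow_eq_of_homotopy (hJ : IsClosed (J : Set N))
    (F : C(unitInterval × unitInterval, FredholmSA J)) (h0 : ∀ t, F (t, 0) = B t)
    (h1 : ∀ t, F (t, 1) = C t) (hl : ∀ s, F (0, s) = B 0) (hr : ∀ s, F (1, s) = B 1) :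
    spectralFlow hJ B = spectralFlow hJ C := by
  obtain ⟨n, hn, h⟩ := exists_mesh hJ F
  have hn0 : (0 : ℝ) ≤ 1 / n := by positivity
  have hB : ∀ r s : unitInterval, dist r s ≤ 1 / n →
      qnorm J (chi (B r).1 - chi (B s).1) < 1 / 2 := by
    intro r s hrs
    rw [← h0, ← h0]
    exact h _ _ (by rw [Prod.dist_eq]; simpa [hn0] using hrs)
  have hC : ∀ r s : unitInterval, dist r s ≤ 1 / n →
      qnorm J (chi (C r).1 - chi (C s).1) < 1 / 2 := by
    intro r s hrs
    rw [← h1, ← h1]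
    exact h _ _ (by rw [Prod.dist_eq]; simpa [hn0] using hrs)
  rw [← (gridPartition B hn hB).flow_eq_spectralFlow hJ,
    ← (gridPartition C hn hC).flow_eq_spectralFlow hJ, FlowPartition.flow_eq,
    FlowPartition.flow_eq]
  let row : unitInterval → K0 (idealAlg J) := fun s => ∑ i : Fin n,
    essCodim J (chi (F (gridPoint i.castSucc, s)).1) (chi (F (gridPoint i.succ, s)).1)
  have hstep : ∀ s s' : unitInterval, dist s s' ≤ 1 / n → row s = row s' := by
    intro s s' hss
    have hg : ∀ i : Fin n, dist (gridPoint i.castSucc) (gridPoint i.succ) ≤ 1 / n := fun i =>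
      dist_le_of_mem_Icc_gridPoint (gridPoint_mem i).1 (gridPoint_mem i).2
    have key := sum_essCodim_ladder hJ (u := fun i : Fin (n + 1) => chi (F (gridPoint i, s)).1)
      (v := fun i : Fin (n + 1) => chi (F (gridPoint i, s')).1)
      (fun _ => isStarProjection_chi _) (fun _ => isStarProjection_chi _)
      (fun i => h _ _ (by rw [Prod.dist_eq]; simpa [hn0] using hss))
      (fun i => h _ _ (by rw [Prod.dist_eq]; simpa [hn0] using hg i))
      (fun i => h _ _ (by rw [Prod.dist_eq]; simpa [hn0] using hg i))
      -- The square carries the sup metric, so the diagonal of a cell is no longer than its sides.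
      (fun i => h _ _ (by rw [Prod.dist_eq]; exact max_le (hg i) hss))
    -- The endpoints do not move during the homotopy, so the two outer rungs vanish.
    simp only [gridPoint_zero, gridPoint_last hn, hl, hr, essCodim_self, add_zero, zero_add] at key
    exact key
  have hrow : ∀ j : ℕ, ∀ hj : j < n + 1, row 0 = row (gridPoint ⟨j, hj⟩) := by
    intro j
    induction j with
    | zero => exact fun hj => congrArg row gridPoint_zero.symm
    | succ j ih =>
      intro hj
      refine (ih (by omega)).trans (hstep _ _ ?_)
      have hm := gridPoint_mem (⟨j, by omega⟩ : Fin n)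
      exact dist_le_of_mem_Icc_gridPoint hm.1 hm.2
  have hend : row 0 = row 1 := by
    rw [← gridPoint_last hn]
    exact hrow n n.lt_succ_self
  refine Eq.trans ?_ (hend.trans ?_)
  · refine Finset.sum_congr rfl fun i _ => ?_
    rw [h0, h0]
    rfl
  · refine Finset.sum_congr rfl fun i _ => ?_
    rw [h1, h1]
    rfl

theorem spectralFlow_eq_of_sub_mem (hJ : IsClosed (J : Set N)) (h : ∀ t, (B t).1 - (C t).1 ∈ J)
    (h0 : essCodim J (chi (B 0).1) (chi (C 0).1) = 0)
    (h1 : essCodim J (chi (B 1).1) (chi (C 1).1) = 0) :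
    spectralFlow hJ B = spectralFlow hJ C := by
  obtain ⟨P⟩ := nonempty_flowPartition hJ B
  have hBC : ∀ t, Ideal.Quotient.mk J (chi (B t).1) = Ideal.Quotient.mk J (chi (C t).1) := fun t =>
    Ideal.Quotient.eq.2 (mem_of_qnorm_eq_zero hJ (qnorm_chi_sub_eq_zero hJ (h t)))
  -- The spectral projections of the two paths agree modulo `J`, so the same subdivision is
  -- admissible for `C`.
  let Q : FlowPartition J C :=
    { n := P.n
      t := P.t
      strictMono := P.strictMono
      first := P.first
      last := P.last
      small := fun i r hr s hs => by
        rw [← hBC, ← hBC]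
        exact P.small i r hr s hs }
  rw [← P.flow_eq_spectralFlow hJ, ← Q.flow_eq_spectralFlow hJ, P.flow_eq, Q.flow_eq]
  have hsm : ∀ i : Fin P.n, ‖Ideal.Quotient.mk J (chi (B (P.t i.castSucc)).1) -
      Ideal.Quotient.mk J (chi (B (P.t i.succ)).1)‖ < 1 / 2 := by
    intro i
    have hle : P.t i.castSucc ≤ P.t i.succ := P.strictMono.monotone i.castSucc_le_succ
    exact P.small i _ (Set.left_mem_Icc.2 hle) _ (Set.right_mem_Icc.2 hle)
  have key := sum_essCodim_ladder hJ (u := fun i => chi (B (P.t i)).1)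
    (v := fun i => chi (C (P.t i)).1)
    (fun _ => isStarProjection_chi _) (fun _ => isStarProjection_chi _)
    (fun i => by rw [qnorm_sub, hBC, sub_self, norm_zero]; norm_num)
    (fun i => by rw [qnorm_sub]; exact hsm i)
    (fun i => by rw [qnorm_sub, ← hBC, ← hBC]; exact hsm i)
    (fun i => by rw [qnorm_sub, ← hBC (P.t i.succ)]; exact hsm i)
  simp only [P.first, P.last, h0, h1, add_zero, zero_add] at key
  exact key

end SpectralFlow

end VNFlow

end

/-! ### Assembly of the four statements. -/

open VNFlow
theorem mainTheorem9 {H : Type*} [NormedAddCommGroup H] [InnerProductSpace ℂ H] [CompleteSpace H]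
    (N : VonNeumannAlgebra H) (J : Ideal N) [J.IsTwoSided] (hJ : IsClosed (J : Set N)) :
    -- additivity of the index for three projections that are pairwise close modulo `J`
    (∀ (p q r : N) (hp : IsStarProjection p) (hq : IsStarProjection q) (hr : IsStarProjection r),
      ‖Ideal.Quotient.mk J p - Ideal.Quotient.mk J q‖ < 1 / 2 →
      ‖Ideal.Quotient.mk J q - Ideal.Quotient.mk J r‖ < 1 / 2 →
      ‖Ideal.Quotient.mk J r - Ideal.Quotient.mk J p‖ < 1 / 2 →
      ∃ (hrq : IsRelFredholm J r q (r * q)) (hqp : IsRelFredholm J q p (q * p))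
        (hrp : IsRelFredholm J r p (r * p)),
        relIndex hr hq hrq + relIndex hq hp hqp = relIndex hr hp hrp) ∧
    -- admissible partitions exist, and all of them give the same spectral flow
    (∀ B : C(unitInterval, FredholmSA J),
      Nonempty (FlowPartition J B) ∧
      ∀ P : FlowPartition J B, P.flow hJ = spectralFlow hJ B) ∧
    -- invariance under homotopies with fixed endpoints
    (∀ (B C : C(unitInterval, FredholmSA J)) (F : C(unitInterval × unitInterval, FredholmSA J)),
      (∀ t, F (t, 0) = B t) → (∀ t, F (t, 1) = C t) →
      (∀ s, F (0, s) = B 0) → (∀ s, F (1, s) = B 1) →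
      spectralFlow hJ B = spectralFlow hJ C) ∧
    -- invariance under perturbations in `J`
    (∀ B C : C(unitInterval, FredholmSA J), (∀ t, (B t).1 - (C t).1 ∈ J) →
      ∃ (h0 : IsRelFredholm J (chi (B 0).1) (chi (C 0).1) (chi (B 0).1 * chi (C 0).1))
        (h1 : IsRelFredholm J (chi (C 1).1) (chi (B 1).1) (chi (C 1).1 * chi (B 1).1)),
        (relIndex (isStarProjection_chi _) (isStarProjection_chi _) h0 = 0 →
          relIndex (isStarProjection_chi _) (isStarProjection_chi _) h1 = 0 →
          spectralFlow hJ B = spectralFlow hJ C) ∧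
        (‖chi (B 0).1 - chi (C 0).1‖ < 1 →
          relIndex (isStarProjection_chi _) (isStarProjection_chi _) h0 = 0) ∧
        (‖chi (C 1).1 - chi (B 1).1‖ < 1 →
          relIndex (isStarProjection_chi _) (isStarProjection_chi _) h1 = 0)) := by
  have hhalf : (1 / 2 : ℝ) < 1 := by norm_num
  refine ⟨?_, ?_, ?_, ?_⟩
  · intro p q r hp hq hr hpq hqr hrp
    rw [norm_sub_rev] at hrp
    rw [← qnorm_sub] at hpq hqr hrp
    refine ⟨isRelFredholm_mul hq hr (hqr.trans hhalf), isRelFredholm_mul hp hq (hpq.trans hhalf),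
      isRelFredholm_mul hp hr (hrp.trans hhalf), ?_⟩
    rw [relIndex_eq_essCodim hJ hq hr (hqr.trans hhalf),
      relIndex_eq_essCodim hJ hp hq (hpq.trans hhalf),
      relIndex_eq_essCodim hJ hp hr (hrp.trans hhalf), add_comm]
    exact essCodim_add hJ hp hq hr hpq hqr hrp
  · exact fun B => ⟨nonempty_flowPartition hJ B, fun P => P.flow_eq_spectralFlow hJ⟩
  · exact fun B C F h0 h1 hl hr => spectralFlow_eq_of_homotopy hJ F h0 h1 hl hr
  · intro B C h
    have hz : ∀ t, qnorm J (chi (B t).1 - chi (C t).1) < 1 := fun t =>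
      (qnorm_chi_sub_eq_zero hJ (h t)).trans_lt one_pos
    have hz' : ∀ t, qnorm J (chi (C t).1 - chi (B t).1) < 1 := fun t => by
      rw [qnorm_sub_rev]
      exact hz t
    have h0 := isRelFredholm_mul (isStarProjection_chi _) (isStarProjection_chi _) (hz' 0)
    have h1 := isRelFredholm_mul (isStarProjection_chi _) (isStarProjection_chi _) (hz 1)
    refine ⟨h0, h1, ?_⟩
    rw [relIndex_eq_essCodim hJ (isStarProjection_chi _) (isStarProjection_chi _) (hz' 0) h0,
      relIndex_eq_essCodim hJ (isStarProjection_chi _) (isStarProjection_chi _) (hz 1) h1]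
    refine ⟨fun e0 e1 => spectralFlow_eq_of_sub_mem hJ h ?_ e1, fun hn => ?_, fun hn => ?_⟩
    -- At t = 0 the index is taken from χ(C₀) to χ(B₀), opposite to the direction of the rung.
    · rw [essCodim_swap, e0, neg_zero]
    · rw [norm_sub_rev] at hn
      exact essCodim_eq_zero (isStarProjection_chi _).isIdempotentElem
        (isStarProjection_chi _).isIdempotentElem hn
    · rw [norm_sub_rev] at hn
      exact essCodim_eq_zero (isStarProjection_chi _).isIdempotentElem
        (isStarProjection_chi _).isIdempotentElem hn
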